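/- Let $(M^{2n},\omega)$ be an almost symplectic manifold, that is, a $C^\infty$ manifold of dimension $2n$ with a non degenerate $2$-form $\omega$ of class $C^\infty$. Assume $n\ge 3$. For a $k$-form $\nu$ put $\star\nu=i(\sharp_\omega\nu)(\omega^n/n!)$, where $\sharp_\omega$ is the multiplicative extension to forms of the inverse of $X\mapsto i(X)\omega$ and $i(X_1\wedge\dots\wedge X_k)\alpha=\alpha(X_1,\dots,X_k,\cdot)$; put $\delta=\star d\star$, $\sigma=\frac1{n-1}\delta\omega$ and $\psi=d\omega-\sigma\wedge\omega$. For an open set $U\subseteq M$, a function $f\in C^\infty(U)$ is called Hamiltonian on $U$ if there is a $C^\infty$ vector field $X_f$ on $U$ (the Hamiltonian field of $f$) with $L_{X_f}\omega=0$ and $i(X_f)\omega=-df$ on $U$; the Poisson bracket of two such functions is $\{f,h\}=\omega(X_f,X_h)$. Suppose that $\psi=0$ on $M$ and that $\{x\in M:\sigma_x\ne0\}$ is dense in $M$. Then: 1. $\sigma$ is ($C^\infty$ and) closed, and $(M,\omega)$ is locally conformal symplectic with Lee form $\sigma$: every point of $M$ has an open neighborhood $U$ with a function $t\in C^\infty(U)$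 such that $\sigma=dt$ and $d(e^{-t}\omega)=0$ on $U$. 2. Let $U\subseteq M$ be open, $t\in C^\infty(U)$ with $\sigma=dt$ on $U$, and $f\in C^\infty(U)$. Then $f$ is Hamiltonian on $U$ if and only if $f=f(t)$ in the following local sense: every point $x\in U$ with $\sigma_x\neq0$ has a neighborhood in $U$ on which $f=\varphi(t)$ for some $\varphi\in C^\infty(\mathbb R)$. If, moreover, $\sigma$ has no zeros on $U$ and the level sets $\{x\in U: t(x)=c\}$, $c\in\mathbb R$, are connected or empty, then $f$ is Hamiltonian on $U$ if and only if $f=\varphi(t)$ on all of $U$ for some $\varphi\in C^\infty(t(U))$. 3. For every open $U\subseteq M$ (in particular $U=M$) and all Hamiltonian functions $f,h$ on $U$, $\{f,h\}=0$ on $U$. -/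

import Mathlib

open scoped Manifold ContDiff Topology

noncomputable section

namespace AlmostSymplectic

/-! ## Exterior algebra of a real vector space -/

section Update

variable {V : Type*} {k l : ℕ}

theorem update_castAdd_castAdd (v : Fin (k + l) → V) (i : Fin k) (x : V) :
    (fun a => Function.update v (Fin.castAdd l i) x (Fin.castAdd l a)) =
      Function.update (fun a => v (Fin.castAdd l a)) i x :=
  Function.update_comp_eq_of_injective v (Fin.castAdd_injective k l) i x

theorem update_natAdd_natAdd (v : Fin (k + l) → V) (i : Fin l) (x : V) :
    (fun a => Function.update v (Fin.natAdd k i) x (Fin.natAdd k a)) =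
      Function.update (fun a => v (Fin.natAdd k a)) i x :=
  Function.update_comp_eq_of_injective v (Fin.natAdd_injective l k) i x

theorem update_castAdd_natAdd (v : Fin (k + l) → V) (i : Fin k) (x : V) :
    (fun a => Function.update v (Fin.castAdd l i) x (Fin.natAdd k a)) =
      fun a => v (Fin.natAdd k a) := by
  funext a
  exact Function.update_of_ne (by simp [Fin.ext_iff]; omega) _ _

theorem update_natAdd_castAdd (v : Fin (k + l) → V) (i : Fin l) (x : V) :
    (fun a => Function.update v (Fin.natAdd k i) x (Fin.castAdd l a)) =
      fun a => v (Fin.castAdd l a) := by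
  funext a
  exact Function.update_of_ne (by simp [Fin.ext_iff]; omega) _ _

theorem append_update_right (w : Fin k → V) (v : Fin l → V) (i : Fin l) (x : V) :
    Fin.append w (Function.update v i x) =
      Function.update (Fin.append w v) (Fin.natAdd k i) x := by
  funext a
  induction a using Fin.addCases with
  | left a =>
    rw [congrFun (update_natAdd_castAdd (Fin.append w v) i x) a]
    simp
  | right a =>
    rw [congrFun (update_natAdd_natAdd (Fin.append w v) i x) a]
    simp

end Update

section Algebra

variable {V : Type*} [AddCommGroup V] [Module ℝ V] [TopologicalSpace V]
  [IsTopologicalAddGroup V] [ContinuousSMul ℝ V]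

/-- The multilinear map `(v₁, …, v_{k+l}) ↦ α(v₁, …, v_k) * β(v_{k+1}, …, v_{k+l})`. -/
def mulForms {k l : ℕ} (α : V [⋀^Fin k]→L[ℝ] ℝ) (β : V [⋀^Fin l]→L[ℝ] ℝ) :
    ContinuousMultilinearMap ℝ (fun _ : Fin (k + l) => V) ℝ where
  toFun v := α (fun i => v (Fin.castAdd l i)) * β (fun j => v (Fin.natAdd k j))
  map_update_add' := by
    intro inst v i x y
    obtain rfl : inst = instDecidableEqFin (k + l) := Subsingleton.elim _ _
    induction i using Fin.addCases with
    | left i =>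
      simp only [update_castAdd_castAdd, update_castAdd_natAdd,
        ContinuousAlternatingMap.map_update_add, add_mul]
    | right i =>
      simp only [update_natAdd_castAdd, update_natAdd_natAdd,
        ContinuousAlternatingMap.map_update_add, mul_add]
  map_update_smul' := by
    intro inst v i c x
    obtain rfl : inst = instDecidableEqFin (k + l) := Subsingleton.elim _ _
    induction i using Fin.addCases with
    | left i =>
      simp only [update_castAdd_castAdd, update_castAdd_natAdd,
        ContinuousAlternatingMap.map_update_smul, smul_eq_mul, mul_assoc]
    | right i =>
      simp only [update_natAdd_castAdd, update_natAdd_natAdd,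
        ContinuousAlternatingMap.map_update_smul, smul_eq_mul]
      ring
  cont := by
    refine Continuous.mul ?_ ?_
    · exact α.cont.comp (by fun_prop)
    · exact β.cont.comp (by fun_prop)

/-- The exterior product of forms, with the normalization
`(α ∧ β)(v) = 1/(k! l!) ∑_τ sign(τ) α(v_{τ 1}, …, v_{τ k}) β(v_{τ (k+1)}, …, v_{τ (k+l)})`. -/
def wedge {k l : ℕ} (α : V [⋀^Fin k]→L[ℝ] ℝ) (β : V [⋀^Fin l]→L[ℝ] ℝ) :
    V [⋀^Fin (k + l)]→L[ℝ] ℝ :=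
  ((k.factorial * l.factorial : ℝ)⁻¹) •
    ContinuousMultilinearMap.alternatization (mulForms α β)

/-- The exterior power `Ω ^ k` of a `2`-form. -/
def wedgePow (Ω : V [⋀^Fin 2]→L[ℝ] ℝ) : (k : ℕ) → V [⋀^Fin (2 * k)]→L[ℝ] ℝ
  | 0 => ContinuousAlternatingMap.constOfIsEmpty ℝ V (Fin 0) 1
  | k + 1 => wedge (wedgePow Ω k) Ω

/-- Contraction of a form with the decomposable multivector `w₁ ∧ … ∧ w_k`:
`i(w₁ ∧ … ∧ w_k) α = α(w₁, …, w_k, ·, …, ·)`. -/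
def contract {m k r : ℕ} (h : k + r = m) (w : Fin k → V) (α : V [⋀^Fin m]→L[ℝ] ℝ) :
    V [⋀^Fin r]→L[ℝ] ℝ where
  toFun v := α (fun j => Fin.append w v (Fin.cast h.symm j))
  map_update_add' := by
    subst h
    intro inst v i x y
    obtain rfl : inst = instDecidableEqFin r := Subsingleton.elim _ _
    simp only [Fin.cast_refl, id, append_update_right, ContinuousAlternatingMap.map_update_add]
  map_update_smul' := by
    subst h
    intro inst v i c x
    obtain rfl : inst = instDecidableEqFin r := Subsingleton.elim _ _
    simp only [Fin.cast_refl, id, append_update_right, ContinuousAlternatingMap.map_update_smul]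
  map_eq_zero_of_eq' := by
    subst h
    intro v i j hv hij
    refine α.map_eq_zero_of_eq _ (i := Fin.natAdd k i) (j := Fin.natAdd k j) ?_ ?_
    · simpa using hv
    · simpa using hij
  cont := by
    subst h
    refine α.cont.comp (continuous_pi fun j => ?_)
    induction j using Fin.addCases with
    | left j => simpa using continuous_const
    | right j => simpa using continuous_apply j

/-- The vector `♯_Ω e^i`, where `(e^i)` is the basis dual to `b`, that is, the solution `X` of
`Ω(X, ·) = e^i`; in components, it is the `i`-th row of the inverse of the matrix
`Ω(b_j, b_k)`. -/
def sharpDual {m : ℕ} (b : Module.Basis (Fin m) ℝ V) (Ω : V [⋀^Fin 2]→L[ℝ] ℝ) (i : Fin m) : V :=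
  ∑ j, (Matrix.of fun p q => Ω ![b p, b q])⁻¹ i j • b j

/-- The symplectic star operator `⋆ν = i(♯_Ω ν) (Ω^n / n!)` on `k`-forms, `k + r = 2n`, where
`♯_Ω` is extended to forms multiplicatively, that is,
`♯_Ω ν = 1/k! ∑ ν(b_{i₁}, …, b_{i_k}) ♯_Ω e^{i₁} ∧ … ∧ ♯_Ω e^{i_k}`. -/
def star {n k r : ℕ} (h : k + r = 2 * n) (b : Module.Basis (Fin (2 * n)) ℝ V)
    (Ω : V [⋀^Fin 2]→L[ℝ] ℝ) (ν : V [⋀^Fin k]→L[ℝ] ℝ) : V [⋀^Fin r]→L[ℝ] ℝ :=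
  (k.factorial : ℝ)⁻¹ • ∑ I : Fin k → Fin (2 * n),
    ν (fun a => b (I a)) •
      contract h (fun a => sharpDual b Ω (I a)) ((n.factorial : ℝ)⁻¹ • wedgePow Ω n)

end Algebra

/-! ## Differential forms on a manifold of dimension `2n` -/

section Manifold

variable (n : ℕ) (M : Type*) [TopologicalSpace M]
  [ChartedSpace (EuclideanSpace ℝ (Fin (2 * n))) M]

/-- Differential `k`-forms (without regularity) on `M`. -/
abbrev DForm (k : ℕ) : Type _ :=
  (x : M) → TangentSpace (𝓡 (2 * n)) x [⋀^Fin k]→L[ℝ] ℝ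

/-- Vector fields (without regularity) on `M`. -/
abbrev VField : Type _ := (x : M) → TangentSpace (𝓡 (2 * n)) x

variable {n M}

/-- The expression of the form `α` in the chart at `p`, that is, its pull-back by the inverse of
this chart. -/
def chartForm {k : ℕ} (p : M) (α : DForm n M k) (y : EuclideanSpace ℝ (Fin (2 * n))) :
    EuclideanSpace ℝ (Fin (2 * n)) [⋀^Fin k]→L[ℝ] ℝ :=
  (α ((chartAt (EuclideanSpace ℝ (Fin (2 * n))) p).symm y)).compContinuousLinearMap
    (mfderiv (𝓡 (2 * n)) (𝓡 (2 * n)) (chartAt (EuclideanSpace ℝ (Fin (2 * n))) p).symm y)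

/-- The expression of the vector field `X` in the chart at `p`. -/
def chartField (p : M) (X : VField n M) (y : EuclideanSpace ℝ (Fin (2 * n))) :
    EuclideanSpace ℝ (Fin (2 * n)) :=
  mfderiv (𝓡 (2 * n)) (𝓡 (2 * n)) (chartAt (EuclideanSpace ℝ (Fin (2 * n))) p)
    ((chartAt (EuclideanSpace ℝ (Fin (2 * n))) p).symm y)
    (X ((chartAt (EuclideanSpace ℝ (Fin (2 * n))) p).symm y))

/-- The form `α` is of class `C^∞` on `M`: so are its expressions in the charts. -/
def IsSmoothForm {k : ℕ} (α : DForm n M k) : Prop :=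
  ∀ p : M, ContDiffOn ℝ ∞ (chartForm p α) (chartAt (EuclideanSpace ℝ (Fin (2 * n))) p).target

/-- The exterior derivative, computed at `x` in the chart at `x`. -/
def dForm {k : ℕ} (α : DForm n M k) : DForm n M (k + 1) := fun x =>
  (extDeriv (chartForm x α)
      (chartAt (EuclideanSpace ℝ (Fin (2 * n))) x x)).compContinuousLinearMap
    (mfderiv (𝓡 (2 * n)) (𝓡 (2 * n)) (chartAt (EuclideanSpace ℝ (Fin (2 * n))) x) x)

/-- The value `(L_X α)_x(v₁, …, v_k)` of the Lie derivative, computed in the chart at `x` by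
`L_X α (v₁, …, v_k) = (D_X α)(v₁, …, v_k) + ∑ᵢ α(v₁, …, D_{vᵢ} X, …, v_k)`, in components
`X^j ∂_j α_{i₁ … i_k} + ∑_a (∂_{i_a} X^j) α_{i₁ … j … i_k}`. -/
def lieDeriv {k : ℕ} (X : VField n M) (α : DForm n M k) (x : M)
    (v : Fin k → TangentSpace (𝓡 (2 * n)) x) : ℝ :=
  let y : EuclideanSpace ℝ (Fin (2 * n)) := chartAt (EuclideanSpace ℝ (Fin (2 * n))) x x
  let w : Fin k → EuclideanSpace ℝ (Fin (2 * n)) := fun i =>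
    mfderiv (𝓡 (2 * n)) (𝓡 (2 * n)) (chartAt (EuclideanSpace ℝ (Fin (2 * n))) x) x (v i)
  fderiv ℝ (chartForm x α) y (chartField x X y) w +
    ∑ i, chartForm x α y (Function.update w i (fderiv ℝ (chartField x X) y (w i)))

/-- A closed form: a `C^∞` form with vanishing exterior derivative. -/
def IsClosedForm {k : ℕ} (α : DForm n M k) : Prop :=
  IsSmoothForm α ∧ ∀ x, dForm α x = 0

/-- An almost symplectic form: a non degenerate `2`-form of class `C^∞`. -/
structure IsAlmostSymplectic (Ω : DForm n M 2) : Prop where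
  smooth : IsSmoothForm Ω
  nondegenerate : ∀ (x : M) (v : TangentSpace (𝓡 (2 * n)) x), (∀ w, Ω x ![v, w] = 0) → v = 0

/-- The basis of `T_x M` given by the chart at `x`. -/
def tangentBasis (x : M) : Module.Basis (Fin (2 * n)) ℝ (TangentSpace (𝓡 (2 * n)) x) :=
  (EuclideanSpace.basisFun (Fin (2 * n)) ℝ).toBasis

/-- The star operator of `Ω` on `k`-forms, `k + r = 2n`. -/
def starForm {k r : ℕ} (h : k + r = 2 * n) (Ω : DForm n M 2) (ν : DForm n M k) : DForm n M r :=
  fun x => star h (tangentBasis x) (Ω x) (ν x)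

/-- The codifferential `δ = ⋆ d ⋆` on `k`-forms; here `k + r = 2n` and `l = k - 1`. -/
def codiff {k r l : ℕ} (h : k + r = 2 * n) (h' : r + 1 + l = 2 * n) (Ω : DForm n M 2)
    (ν : DForm n M k) : DForm n M l :=
  starForm h' Ω (dForm (starForm h Ω ν))

/-- The `1`-form `σ = 1/(n-1) δΩ`. -/
def leeForm (hn : 1 ≤ n) (Ω : DForm n M 2) : DForm n M 1 := fun x =>
  ((n : ℝ) - 1)⁻¹ • codiff (k := 2) (r := 2 * n - 2) (l := 1) (by omega) (by omega) Ω Ω x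

/-- The `3`-form `ψ` of the decomposition `dΩ = σ ∧ Ω + ψ`. -/
def psiForm (hn : 1 ≤ n) (Ω : DForm n M 2) : DForm n M 3 := fun x =>
  dForm Ω x - wedge (leeForm hn Ω x) (Ω x)

/-- `X` is a Hamiltonian vector field of the function `f` on the open set `U`:
`X` and `f` are `C^∞` on `U`, `L_X Ω = 0` and `i(X) Ω = - df` on `U`. -/
structure IsHamiltonianFieldOn [IsManifold (𝓡 (2 * n)) ∞ M] (Ω : DForm n M 2) (U : Set M)
    (f : M → ℝ) (X : VField n M) : Prop where
  smooth_fun : ContMDiffOn (𝓡 (2 * n)) 𝓘(ℝ, ℝ) ∞ f U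
  smooth_field : ContMDiffOn (𝓡 (2 * n)) (𝓡 (2 * n)).tangent ∞
    (fun x => (⟨x, X x⟩ : TangentBundle (𝓡 (2 * n)) M)) U
  lieDeriv_eq_zero : ∀ x ∈ U, ∀ v, lieDeriv X Ω x v = 0
  contraction : ∀ x ∈ U, ∀ v : TangentSpace (𝓡 (2 * n)) x,
    Ω x ![X x, v] = - mfderiv (𝓡 (2 * n)) 𝓘(ℝ, ℝ) f x v

/-- `f` is a Hamiltonian function on the open set `U`. -/
def IsHamiltonianOn [IsManifold (𝓡 (2 * n)) ∞ M] (Ω : DForm n M 2) (U : Set M) (f : M → ℝ) : Prop :=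
  ∃ X : VField n M, IsHamiltonianFieldOn Ω U f X

/-- `t` is a `C^∞` function on the open set `U` and `θ = dt` on `U`. -/
def IsPrimitiveOn (θ : DForm n M 1) (U : Set M) (t : M → ℝ) : Prop :=
  ContMDiffOn (𝓡 (2 * n)) 𝓘(ℝ, ℝ) ∞ t U ∧
    ∀ x ∈ U, ∀ v : TangentSpace (𝓡 (2 * n)) x,
      θ x ![v] = mfderiv (𝓡 (2 * n)) 𝓘(ℝ, ℝ) t x v

/-- `(M, Ω)` is locally conformal symplectic with Lee form `θ`: each point has an open
neighborhood with a `C^∞` function `t` such that `θ = dt` and `e^{-t} Ω` is closed there. -/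
def IsLocallyConformalSymplectic (Ω : DForm n M 2) (θ : DForm n M 1) : Prop :=
  IsAlmostSymplectic Ω ∧ ∀ p : M, ∃ (U : Set M) (t : M → ℝ), IsOpen U ∧ p ∈ U ∧
    IsPrimitiveOn θ U t ∧ ∀ x ∈ U, dForm (fun y => Real.exp (-t y) • Ω y) x = 0

end Manifold

end AlmostSymplectic

end

/-! Only the relation `dΩ = σ ∧ Ω`, which is `ψ = 0`, matters; how `σ` comes from the star operator
plays no role. Since `n ≥ 3`, the exterior product with `Ω` is injective on `1`-forms and on
`2`-forms (`Nondeg.eq_zero_of_wedge_one`, `Nondeg.eq_zero_of_wedge_two`). The first injectivity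
makes `σ` the solution of a smooth linear equation, hence smooth. Differentiating the relation gives
`0 = dσ ∧ Ω - σ ∧ σ ∧ Ω = dσ ∧ Ω`, and the second one yields `dσ = 0`. The Poincaré lemma then
provides `t`.

If `i(X)Ω = -df`, Cartan's formula gives `L_X Ω = i(X)(σ ∧ Ω) = σ(X)Ω + σ ∧ df`. As `σ ∧ df` has
rank at most `2` and `Ω` has rank at least `6`, the equation `L_X Ω = 0` splits into `σ(X) = 0` and
`σ ∧ df = 0` (`Nondeg.eq_zero_of_contraction`). Conversely `σ ∧ df = 0` makes `X` proportional to
the dual of `σ` where `σ ≠ 0`, so `σ(X) = 0` and `f` is Hamiltonian. Where `σ = dt ≠ 0`, the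
condition `dt ∧ df = 0` says that `f` is locally a function of `t` (`exists_contDiff_comp_eq`).

Finally `{f, h} = -df(X_h)` vanishes where `σ ≠ 0`, since there `df` is a multiple of `σ` and
`σ(X_h) = 0`; density and continuity extend this to `U`. -/

noncomputable section

namespace AlmostSymplectic

/-! ### Linear algebra of a non degenerate `2`-form. -/

section LinearAlgebra

open ContinuousAlternatingMap

variable {V : Type*} [AddCommGroup V] [Module ℝ V] [TopologicalSpace V]

theorem update_pair_zero {W : Type*} (u v x : W) : Function.update ![u, v] 0 x = ![x, v] := by
  ext i; fin_cases i <;> simp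

theorem update_pair_one {W : Type*} (u v x : W) : Function.update ![u, v] 1 x = ![u, x] := by
  ext i; fin_cases i <;> simp

theorem alternating_two_swap (η : V [⋀^Fin 2]→L[ℝ] ℝ) (u v : V) : η ![u, v] = -η ![v, u] := by
  have h := η.toAlternatingMap.map_swap ![u, v] (i := 0) (j := 1) (by decide)
  have e : ![u, v] ∘ Equiv.swap (0 : Fin 2) 1 = ![v, u] := by
    ext i; fin_cases i <;> simp
  rw [e] at h
  simp only [ContinuousAlternatingMap.coe_toAlternatingMap] at h
  linarith

theorem alternating_two_self (η : V [⋀^Fin 2]→L[ℝ] ℝ) (u : V) : η ![u, u] = 0 := by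
  have := alternating_two_swap η u u
  linarith

/-- A `2`-form as a bilinear form. -/
def toBilin (η : V [⋀^Fin 2]→L[ℝ] ℝ) : LinearMap.BilinForm ℝ V :=
  LinearMap.mk₂ ℝ (fun u v => η ![u, v])
    (fun u u' v => by
      have := η.map_update_add ![u, v] 0 u u'
      simpa only [update_pair_zero, update_pair_one, smul_eq_mul] using this)
    (fun c u v => by
      have := η.map_update_smul ![u, v] 0 c u
      simpa only [update_pair_zero, update_pair_one, smul_eq_mul] using this)
    (fun u v v' => by
      have := η.map_update_add ![u, v] 1 v v'
      simpa only [update_pair_zero, update_pair_one, smul_eq_mul] using this)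
    (fun c u v => by
      have := η.map_update_smul ![u, v] 1 c v
      simpa only [update_pair_zero, update_pair_one, smul_eq_mul] using this)

@[simp]
theorem toBilin_apply (η : V [⋀^Fin 2]→L[ℝ] ℝ) (u v : V) : toBilin η u v = η ![u, v] := rfl

theorem alternating_two_add_left (η : V [⋀^Fin 2]→L[ℝ] ℝ) (u u' v : V) :
    η ![u + u', v] = η ![u, v] + η ![u', v] := by
  simp [← toBilin_apply]

theorem alternating_two_smul_left (η : V [⋀^Fin 2]→L[ℝ] ℝ) (c : ℝ) (u v : V) :
    η ![c • u, v] = c * η ![u, v] := by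
  simp [← toBilin_apply]

theorem alternating_two_add_right (η : V [⋀^Fin 2]→L[ℝ] ℝ) (u v v' : V) :
    η ![u, v + v'] = η ![u, v] + η ![u, v'] := by
  simp [← toBilin_apply]

theorem alternating_two_smul_right (η : V [⋀^Fin 2]→L[ℝ] ℝ) (c : ℝ) (u v : V) :
    η ![u, c • v] = c * η ![u, v] := by
  simp [← toBilin_apply]

/-- Non degeneracy of a `2`-form. -/
def Nondeg (η : V [⋀^Fin 2]→L[ℝ] ℝ) : Prop := ∀ v, (∀ w, η ![v, w] = 0) → v = 0

theorem toBilin_isRefl (η : V [⋀^Fin 2]→L[ℝ] ℝ) : (toBilin η).IsRefl := by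
  intro u v h
  simp only [toBilin_apply] at h ⊢
  rw [alternating_two_swap, h, neg_zero]

theorem Nondeg.toBilin_nondegenerate {η : V [⋀^Fin 2]→L[ℝ] ℝ} (h : Nondeg η) :
    (toBilin η).Nondegenerate :=
  (toBilin_isRefl η).nondegenerate_iff_separatingLeft.2 h

/-- The orthogonal complement of two vectors contains a pair of conjugate vectors. -/
theorem Nondeg.exists_pair {η : V [⋀^Fin 2]→L[ℝ] ℝ} (h : Nondeg η) [FiniteDimensional ℝ V]
    (hV : 5 ≤ Module.finrank ℝ V) (a b : V) :
    ∃ c d, η ![a, c] = 0 ∧ η ![b, c] = 0 ∧ η ![a, d] = 0 ∧ η ![b, d] = 0 ∧ η ![c, d] = 1 := by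
  classical
  set W := Submodule.span ℝ ({a, b} : Set V) with hW
  have ha : a ∈ W := Submodule.subset_span (by simp)
  have hb : b ∈ W := Submodule.subset_span (by simp)
  have hWr : Module.finrank ℝ W ≤ 2 := by
    have := finrank_span_finset_le_card (R := ℝ) ({a, b} : Finset V)
    rw [Finset.coe_pair] at this
    exact this.trans Finset.card_le_two
  have key : ∃ c ∈ (toBilin η).orthogonal W, ∃ d ∈ (toBilin η).orthogonal W, η ![c, d] ≠ 0 := by
    -- Otherwise the orthogonal of `W` lies in its own orthogonal; but the former has dimension at
    -- least `5 - 2 = 3` and the latter has the dimension of `W`, at most `2`.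
    by_contra! hcon
    have hle : (toBilin η).orthogonal W ≤ (toBilin η).orthogonal ((toBilin η).orthogonal W) :=
      fun d hd c hc => hcon c hc d hd
    have h1 := Submodule.finrank_mono hle
    have h2 := LinearMap.BilinForm.finrank_orthogonal h.toBilin_nondegenerate W
    have h3 := LinearMap.BilinForm.finrank_orthogonal h.toBilin_nondegenerate
      ((toBilin η).orthogonal W)
    omega
  obtain ⟨c, hc, d, hd, hcd⟩ := key
  refine ⟨c, (η ![c, d])⁻¹ • d, hc a ha, hc b hb, ?_, ?_, ?_⟩
  · rw [alternating_two_smul_right, show η ![a, d] = 0 from hd a ha, mul_zero]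
  · rw [alternating_two_smul_right, show η ![b, d] = 0 from hd b hb, mul_zero]
  · rw [alternating_two_smul_right, inv_mul_cancel₀ hcd]

/-- The exterior product with a non degenerate `2`-form is injective on `1`-forms. -/
theorem Nondeg.eq_zero_of_wedge_one {η : V [⋀^Fin 2]→L[ℝ] ℝ} (h : Nondeg η)
    [FiniteDimensional ℝ V] (hV : 5 ≤ Module.finrank ℝ V) {s : V → ℝ}
    (hs : ∀ u v w, s u * η ![v, w] - s v * η ![u, w] + s w * η ![u, v] = 0) (u : V) : s u = 0 := by
  obtain ⟨c, d, h1, -, h3, -, h5⟩ := h.exists_pair hV u u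
  have := hs u c d
  rw [h1, h3, h5] at this
  linarith

/-- In dimension at least `6`, the exterior product with a non degenerate `2`-form is injective on
`2`-forms. -/
theorem Nondeg.eq_zero_of_wedge_two {η : V [⋀^Fin 2]→L[ℝ] ℝ} (h : Nondeg η)
    [FiniteDimensional ℝ V] (hV : 5 ≤ Module.finrank ℝ V) {β : LinearMap.BilinForm ℝ V}
    (hβ : ∀ a b c d, β a b * η ![c, d] - β a c * η ![b, d] + β a d * η ![b, c] +
      β b c * η ![a, d] - β b d * η ![a, c] + β c d * η ![a, b] = 0) (a b : V) :
    β a b = 0 := by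
  -- For `c, d` conjugate and orthogonal to `a, b`, only `β(a,b) + β(c,d) η(a,b)` survives in the
  -- hypothesis.
  have h0 : ∀ a b, η ![a, b] = 0 → β a b = 0 := by
    intro a b hab
    obtain ⟨c, d, h1, h2, h3, h4, h5⟩ := h.exists_pair hV a b
    have := hβ a b c d
    rw [h1, h2, h3, h4, h5, hab] at this
    linarith
  obtain ⟨c, d, h1, h2, h3, h4, h5⟩ := h.exists_pair hV a b
  have e1 := hβ a b c d
  rw [h1, h2, h3, h4, h5] at e1
  -- These two vectors are orthogonal for `η`, so `h0` yields `β(a,b) = η(a,b) β(c,d)`, whereas `e1`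
  -- is the same equality with the opposite sign.
  have e2 := h0 (a + η ![a, b] • c) (b - d) (by
    simp only [sub_eq_add_neg, alternating_two_add_left, alternating_two_add_right,
      alternating_two_smul_left, ← neg_one_smul ℝ d, alternating_two_smul_right,
      alternating_two_swap η c b, h2, h3, h5]
    ring)
  have e3 : β c b = 0 := h0 c b (by rw [alternating_two_swap, h2, neg_zero])
  have e4 : β a d = 0 := h0 a d h3
  simp only [map_add, map_sub, map_smul, LinearMap.add_apply, LinearMap.smul_apply, e3, e4,
    smul_eq_mul] at e2
  linarith

/-- Two `1`-forms `s`, `g` and a vector `X` with `i(X)η = -g` and `s(X)η - s ∧ i(X)η = 0`. -/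
theorem Nondeg.eq_zero_of_contraction {η : V [⋀^Fin 2]→L[ℝ] ℝ} (h : Nondeg η)
    [FiniteDimensional ℝ V] (hV : 5 ≤ Module.finrank ℝ V) {s g : V → ℝ} {S X : V}
    (hS : ∀ v, η ![S, v] = s v) (hX : ∀ v, η ![X, v] = -g v)
    (hs : ∀ v w, s X * η ![v, w] - s v * η ![X, w] + s w * η ![X, v] = 0) :
    s X = 0 ∧ ∀ v w, s v * g w = s w * g v := by
  -- Both `s = η(S, ·)` and `i(X)η` vanish on a pair orthogonal to `S` and `X`, which isolates the
  -- term `s(X) η(c,d) = s(X)`.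
  obtain ⟨c, d, h1, h2, h3, h4, h5⟩ := h.exists_pair hV S X
  have e := hs c d
  rw [← hS c, ← hS d, h1, h3, h5] at e
  have e0 : s X = 0 := by linarith
  refine ⟨e0, fun v w => ?_⟩
  have := hs v w
  rw [hX, hX, e0] at this
  linarith

theorem Nondeg.exists_sharp {η : V [⋀^Fin 2]→L[ℝ] ℝ} (h : Nondeg η) [FiniteDimensional ℝ V]
    (s : V →ₗ[ℝ] ℝ) : ∃ S, ∀ v, η ![S, v] = s v := by
  refine ⟨(LinearMap.BilinForm.toDual (toBilin η) h.toBilin_nondegenerate).symm s, fun v => ?_⟩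
  rw [← toBilin_apply]
  exact LinearMap.BilinForm.apply_toDual_symm_apply (B := toBilin η) (hB := h.toBilin_nondegenerate) s v

/-- The exterior product of a `1`-form and a `2`-form. -/
theorem wedge_one_two_apply [IsTopologicalAddGroup V] [ContinuousSMul ℝ V]
    (σ : V [⋀^Fin 1]→L[ℝ] ℝ) (η : V [⋀^Fin 2]→L[ℝ] ℝ) (u v w : V) :
    wedge σ η ![u, v, w] =
      σ ![u] * η ![v, w] - σ ![v] * η ![u, w] + σ ![w] * η ![u, v] := by
  have e : ∀ x : Fin 3 → V, mulForms σ η x = σ ![x 0] * η ![x 1, x 2] := by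
    intro x
    change σ _ * η _ = _
    congr 2
    · ext i; fin_cases i; rfl
    · ext i; fin_cases i <;> rfl
  unfold wedge
  rw [ContinuousAlternatingMap.smul_apply,
    ContinuousMultilinearMap.alternatization_apply_apply]
  change _ • ∑ τ : Equiv.Perm (Fin 3), _ = _
  -- The six permutations form three pairs that differ by exchanging the two arguments of `η`; this
  -- doubling cancels the factor `1/(1! 2!)`.
  have hu : (Finset.univ : Finset (Equiv.Perm (Fin 3))) =
      {1, Equiv.swap 0 1, Equiv.swap 0 2, Equiv.swap 1 2, Equiv.swap 0 1 * Equiv.swap 1 2,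
        Equiv.swap 1 2 * Equiv.swap 0 1} := by decide
  rw [hu]
  simp only [e]
  rw [Finset.sum_insert (by decide), Finset.sum_insert (by decide), Finset.sum_insert (by decide),
    Finset.sum_insert (by decide), Finset.sum_insert (by decide), Finset.sum_singleton]
  have a1 : Equiv.swap (0 : Fin 3) 1 2 = 2 := by decide
  have a2 : Equiv.swap (0 : Fin 3) 2 1 = 1 := by decide
  have a3 : Equiv.swap (1 : Fin 3) 2 0 = 0 := by decide
  simp only [Equiv.Perm.sign_mul, Equiv.Perm.sign_swap', Equiv.Perm.coe_mul, Function.comp_apply,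
    Equiv.swap_apply_left, Equiv.swap_apply_right, a1, a2, a3, Equiv.Perm.sign_one,
    Equiv.Perm.coe_one, id]
  simp only [Matrix.cons_val_zero, Matrix.cons_val_one, Matrix.cons_val]
  have a4 : (1 : Fin 3) ≠ 2 := by decide
  have a5 : (0 : Fin 3) ≠ 2 := by decide
  norm_num [Nat.factorial, Units.smul_def, a4, a5]
  rw [alternating_two_swap η w v, alternating_two_swap η w u, alternating_two_swap η v u]
  ring

end LinearAlgebra

/-! ### Calculus of forms on a normed space. -/

section Calculus

open ContinuousAlternatingMap

variable {E F G : Type*} [NormedAddCommGroup E] [NormedSpace ℝ E]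
  [NormedAddCommGroup F] [NormedSpace ℝ F] [NormedAddCommGroup G] [NormedSpace ℝ G]

/-- The solution of a linear equation depending smoothly on a parameter is smooth. -/
theorem contDiffAt_of_clm_apply_eq [FiniteDimensional ℝ F] {m : ℕ∞ω} {T : E → F →L[ℝ] G}
    {g : E → F} {h : E → G} {x : E} (hT : ContDiffAt ℝ m T x) (hinj : Function.Injective (T x))
    (hh : ContDiffAt ℝ m h x) (hev : ∀ᶠ y in 𝓝 x, T y (g y) = h y) : ContDiffAt ℝ m g x := by
  have := FiniteDimensional.complete ℝ F
  -- The range of `T x` is finite dimensional, hence complemented even if `G` is not: project onto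
  -- it, then invert.
  obtain ⟨L, hL⟩ : ∃ L : G →L[ℝ] F, Function.LeftInverse L (T x) := by
    obtain ⟨P, hP⟩ := Submodule.ClosedComplemented.of_finiteDimensional (T x).range
    have hinj' : Function.Injective (T x : F →ₗ[ℝ] G) := hinj
    let e := LinearEquiv.ofInjective (T x : F →ₗ[ℝ] G) hinj'
    refine ⟨(LinearMap.toContinuousLinearMap
      (e.symm : (T x : F →ₗ[ℝ] G).range →ₗ[ℝ] F)) ∘L P, fun v => ?_⟩
    have := hP ⟨T x v, ⟨v, rfl⟩⟩
    simp only [ContinuousLinearMap.comp_apply]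
    erw [this]
    exact e.symm_apply_apply v
  -- `L ∘ T y` is the identity at `y = x`, hence invertible nearby, and `g y = (L ∘ T y)⁻¹ (L (h
  -- y))`.
  have hP : ContDiffAt ℝ m (fun y => L ∘L T y) x := contDiffAt_const.clm_comp hT
  have hPx : L ∘L T x = ContinuousLinearMap.id ℝ F := by ext v; exact hL v
  have hinv : ContDiffAt ℝ m (fun y => Ring.inverse (L ∘L T y)) x := by
    have : ContDiffAt ℝ m Ring.inverse (L ∘L T x) := by
      rw [hPx]; exact contDiffAt_ringInverse ℝ (1 : (F →L[ℝ] F)ˣ)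
    exact this.comp x hP
  refine (hinv.clm_apply (contDiffAt_const.clm_apply hh : ContDiffAt ℝ m (fun y => L (h y)) x)
    ).congr_of_eventuallyEq ?_
  have hunit : ∀ᶠ y in 𝓝 x, IsUnit (L ∘L T y) := by
    refine hP.continuousAt.eventually (Units.isOpen.mem_nhds ?_)
    change IsUnit (L ∘L T x)
    rw [hPx]; exact isUnit_one
  filter_upwards [hev, hunit] with y hy hu
  have := congrArg (fun A : F →L[ℝ] F => A (g y)) (Ring.inverse_mul_cancel _ hu)
  simp only [ContinuousLinearMap.mul_def, ContinuousLinearMap.comp_apply, hy] at this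
  exact this.symm

theorem two_le_infty : (2 : ℕ∞ω) ≤ ∞ := by
  exact WithTop.coe_le_coe.2 le_top

/-- Exterior derivatives in low degree, written out so that identities between forms become linear
combinations of scalar equations. -/
theorem alternatizeUncurryFin_apply_two (f : E →L[ℝ] E [⋀^Fin 1]→L[ℝ] ℝ) (u v : E) :
    alternatizeUncurryFin f ![u, v] = f u ![v] - f v ![u] := by
  rw [alternatizeUncurryFin_apply, Fin.sum_univ_two]
  have e0 : Fin.removeNth 0 ![u, v] = ![v] := by ext i; fin_cases i; rfl
  have e1 : Fin.removeNth 1 ![u, v] = ![u] := by ext i; fin_cases i; rfl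
  rw [e0, e1]
  simp
  ring

theorem alternatizeUncurryFin_apply_three (f : E →L[ℝ] E [⋀^Fin 2]→L[ℝ] ℝ) (u v w : E) :
    alternatizeUncurryFin f ![u, v, w] = f u ![v, w] - f v ![u, w] + f w ![u, v] := by
  rw [alternatizeUncurryFin_apply, Fin.sum_univ_three]
  have e0 : Fin.removeNth 0 ![u, v, w] = ![v, w] := by ext i; fin_cases i <;> rfl
  have e1 : Fin.removeNth 1 ![u, v, w] = ![u, w] := by ext i; fin_cases i <;> rfl
  have e2 : Fin.removeNth 2 ![u, v, w] = ![u, v] := by ext i; fin_cases i <;> rfl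
  rw [e0, e1, e2]
  simp
  ring

theorem alternatizeUncurryFin_apply_four (f : E →L[ℝ] E [⋀^Fin 3]→L[ℝ] ℝ) (u v w x : E) :
    alternatizeUncurryFin f ![u, v, w, x] =
      f u ![v, w, x] - f v ![u, w, x] + f w ![u, v, x] - f x ![u, v, w] := by
  rw [alternatizeUncurryFin_apply, Fin.sum_univ_four]
  have e0 : Fin.removeNth 0 ![u, v, w, x] = ![v, w, x] := by ext i; fin_cases i <;> rfl
  have e1 : Fin.removeNth 1 ![u, v, w, x] = ![u, w, x] := by ext i; fin_cases i <;> rfl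
  have e2 : Fin.removeNth 2 ![u, v, w, x] = ![u, v, x] := by ext i; fin_cases i <;> rfl
  have e3 : Fin.removeNth 3 ![u, v, w, x] = ![u, v, w] := by ext i; fin_cases i <;> rfl
  rw [e0, e1, e2, e3]
  simp [pow_succ]
  ring

/-- The exterior product of a linear form and a `2`-form, as a continuous bilinear map. -/
def wedgeL (E : Type*) [NormedAddCommGroup E] [NormedSpace ℝ E] :
    (E →L[ℝ] ℝ) →L[ℝ] (E [⋀^Fin 2]→L[ℝ] ℝ) →L[ℝ] E [⋀^Fin 3]→L[ℝ] ℝ :=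
  ((ContinuousLinearMap.compL ℝ (E [⋀^Fin 2]→L[ℝ] ℝ) (E →L[ℝ] E [⋀^Fin 2]→L[ℝ] ℝ)
    (E [⋀^Fin 3]→L[ℝ] ℝ)) (alternatizeUncurryFinCLM ℝ E ℝ)) ∘L
      ContinuousLinearMap.smulRightL ℝ E (E [⋀^Fin 2]→L[ℝ] ℝ)

theorem wedgeL_apply (s : E →L[ℝ] ℝ) (η : E [⋀^Fin 2]→L[ℝ] ℝ) (u v w : E) :
    wedgeL E s η ![u, v, w] = s u * η ![v, w] - s v * η ![u, w] + s w * η ![u, v] := by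
  change alternatizeUncurryFin (s.smulRight η) _ = _
  rw [alternatizeUncurryFin_apply_three]
  simp

/-- The map `X ↦ i(X)η`, depending linearly on the `2`-form `η`. -/
def flatL (E : Type*) [NormedAddCommGroup E] [NormedSpace ℝ E] :
    (E [⋀^Fin 2]→L[ℝ] ℝ) →L[ℝ] E →L[ℝ] E →L[ℝ] ℝ :=
  (ContinuousLinearMap.compL ℝ E (E [⋀^Fin 1]→L[ℝ] ℝ) (E →L[ℝ] ℝ)
    ((ofSubsingletonLIE (𝕜 := ℝ) (E := E) (F := ℝ) (0 : Fin 1)).symm.toContinuousLinearEquiv :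
      (E [⋀^Fin 1]→L[ℝ] ℝ) →L[ℝ] (E →L[ℝ] ℝ))) ∘L
    (curryLeftLI (n := 1)).toContinuousLinearMap

theorem flatL_apply (η : E [⋀^Fin 2]→L[ℝ] ℝ) (u v : E) : flatL E η u v = η ![u, v] := by
  change η (Matrix.vecCons u (fun _ => v)) = _
  congr 1
  ext i; fin_cases i <;> rfl

theorem Nondeg.flatL_injective {η : E [⋀^Fin 2]→L[ℝ] ℝ} (h : Nondeg η) :
    Function.Injective (flatL E η) := by
  rw [injective_iff_map_eq_zero]
  intro u hu
  refine h u fun v => ?_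
  rw [← flatL_apply, hu]
  rfl

theorem Nondeg.wedgeL_injective [FiniteDimensional ℝ E] (hE : 5 ≤ Module.finrank ℝ E)
    {η : E [⋀^Fin 2]→L[ℝ] ℝ} (h : Nondeg η) : Function.Injective ((wedgeL E).flip η) := by
  rw [injective_iff_map_eq_zero]
  intro s hs
  ext u
  refine h.eq_zero_of_wedge_one hE (s := s) (fun u v w => ?_) u
  rw [← wedgeL_apply, ← ContinuousLinearMap.flip_apply, hs]
  rfl

variable {η : E → E [⋀^Fin 2]→L[ℝ] ℝ} {s : E → E →L[ℝ] ℝ} {x : E}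

/-- If `dη = s ∧ η`, then `s` is smooth. -/
theorem contDiffAt_of_extDeriv_eq_wedge [FiniteDimensional ℝ E] (hE : 5 ≤ Module.finrank ℝ E)
    (hη : ContDiffAt ℝ ∞ η x) (hn : Nondeg (η x))
    (hs : ∀ᶠ y in 𝓝 x, extDeriv η y = wedgeL E (s y) (η y)) : ContDiffAt ℝ ∞ s x := by
  refine contDiffAt_of_clm_apply_eq (G := E [⋀^Fin 3]→L[ℝ] ℝ) (T := fun y => (wedgeL E).flip (η y)) (h := extDeriv η)
    (contDiffAt_const.clm_apply hη) (hn.wedgeL_injective hE) ?_ (hs.mono fun y hy => hy.symm)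
  have : ContDiffAt ℝ ∞ (fderiv ℝ η) x := hη.fderiv_right (by simp)
  exact (alternatizeUncurryFinCLM (n := 2) ℝ E ℝ).contDiff.contDiffAt.comp x this

/-- If `dη = s ∧ η` with `η` non degenerate in dimension at least `6`, then `s` is closed. -/
theorem fderiv_symm_of_extDeriv_eq_wedge [FiniteDimensional ℝ E] (hE : 5 ≤ Module.finrank ℝ E)
    (hη : ContDiffAt ℝ ∞ η x) (hn : Nondeg (η x))
    (hs : ∀ᶠ y in 𝓝 x, extDeriv η y = wedgeL E (s y) (η y)) (u v : E) :
    fderiv ℝ s x u v = fderiv ℝ s x v u := by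
  have hsx : DifferentiableAt ℝ s x :=
    (contDiffAt_of_extDeriv_eq_wedge hE hη hn hs).differentiableAt (by simp)
  have hηx : DifferentiableAt ℝ η x := hη.differentiableAt (by simp)
  have hd : HasFDerivAt (fun y => wedgeL E (s y) (η y))
      ((wedgeL E (s x)).comp (fderiv ℝ η x) +
        ((wedgeL E).flip (η x)).comp (fderiv ℝ s x)) x := by
    refine ((wedgeL E).hasFDerivAt_of_bilinear hsx.hasFDerivAt hηx.hasFDerivAt).congr_fderiv ?_
    ext u : 1
    simp
  have h0 : extDeriv (fun y => wedgeL E (s y) (η y)) x = 0 := by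
    rw [← (show extDeriv η =ᶠ[𝓝 x] fun y => wedgeL E (s y) (η y) from hs).extDeriv_eq]
    exact extDeriv_extDeriv_apply hη (by rw [minSmoothness_of_isRCLikeNormedField]; exact two_le_infty)
  have hx : alternatizeUncurryFin (fderiv ℝ η x) = wedgeL E (s x) (η x) := hs.self_of_nhds
  rw [extDeriv, hd.fderiv] at h0
  have h1 : ∀ a b c, fderiv ℝ η x a ![b, c] - fderiv ℝ η x b ![a, c] + fderiv ℝ η x c ![a, b] =
      s x a * η x ![b, c] - s x b * η x ![a, c] + s x c * η x ![a, b] := fun a b c => by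
    rw [← alternatizeUncurryFin_apply_three, hx, wedgeL_apply]
  -- `β` is `ds`; it remains to see that `β ∧ η = 0`.
  let β : LinearMap.BilinForm ℝ E := LinearMap.mk₂ ℝ
    (fun u v => fderiv ℝ s x u v - fderiv ℝ s x v u)
    (fun _ _ _ => by simp; ring) (fun _ _ _ => by simp; ring)
    (fun _ _ _ => by simp; ring) (fun _ _ _ => by simp; ring)
  refine sub_eq_zero.1 (hn.eq_zero_of_wedge_two hE (β := β) (fun a b c d => ?_) u v)
  have h2 := congrArg (fun θ : E [⋀^Fin 4]→L[ℝ] ℝ => θ ![a, b, c, d]) h0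
  simp only [alternatizeUncurryFin_apply_four, _root_.add_apply,
    ContinuousLinearMap.comp_apply, ContinuousAlternatingMap.add_apply,
    ContinuousLinearMap.flip_apply, wedgeL_apply] at h2
  rw [show (0 : E [⋀^Fin 4]→L[ℝ] ℝ) ![a, b, c, d] = 0 from rfl] at h2
  simp only [β, LinearMap.mk₂_apply]
  -- `h2` is `ds ∧ η - s ∧ dη = 0`; the multiples of `h1` replace `dη` by `s ∧ η`, and `s ∧ s ∧ η`
  -- cancels.
  linear_combination h2 + s x a * h1 b c d - s x b * h1 a c d + s x c * h1 a b d - s x d * h1 a b c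

/-- If `dη = s ∧ η` and `s = dt`, then `exp (-t) η` is closed. -/
theorem extDeriv_exp_neg_smul {t : E → ℝ} (hη : DifferentiableAt ℝ η x)
    (ht : HasFDerivAt t (s x) x) (hs : extDeriv η x = wedgeL E (s x) (η x)) :
    extDeriv (fun y => Real.exp (-t y) • η y) x = 0 := by
  have h : HasFDerivAt (fun y => Real.exp (-t y) • η y) _ x := (ht.neg.exp).smul hη.hasFDerivAt
  ext v
  have hv : v = ![v 0, v 1, v 2] := by ext i; fin_cases i <;> rfl
  rw [hv, extDeriv, h.fderiv, alternatizeUncurryFin_apply_three]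
  have h1 : alternatizeUncurryFin (fderiv ℝ η x) ![v 0, v 1, v 2] =
    wedgeL E (s x) (η x) ![v 0, v 1, v 2] := by rw [← hs]; rfl
  rw [alternatizeUncurryFin_apply_three, wedgeL_apply] at h1
  simp
  linear_combination Real.exp (-t x) * h1

/-- The Lie derivative of `η` along `X` is `i(X)dη` if `i(X)η` is exact. -/
theorem lieDeriv_eq_extDeriv {X : E → E} {f : E → ℝ} (hη : DifferentiableAt ℝ η x)
    (hX : DifferentiableAt ℝ X x) (hf : ContDiffAt ℝ ∞ f x)
    (h : ∀ᶠ y in 𝓝 x, ∀ v, η y ![X y, v] = -fderiv ℝ f y v) (v w : E) :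
    fderiv ℝ η x (X x) ![v, w] + η x ![fderiv ℝ X x v, w] + η x ![v, fderiv ℝ X x w] =
      extDeriv η x ![X x, v, w] := by
  have hf2 : ∀ u v, fderiv ℝ (fderiv ℝ f) x u v = fderiv ℝ (fderiv ℝ f) x v u :=
    fun u v => (hf.isSymmSndFDerivAt (by rw [minSmoothness_of_isRCLikeNormedField]; exact two_le_infty)).eq u v
  have hdf : DifferentiableAt ℝ (fderiv ℝ f) x :=
    (hf.fderiv_right (m := ∞) (by simp)).differentiableAt (by simp)
  -- This is the derivative of `i(X)η = -df`. Antisymmetrizing it removes the Hessian of `f`: the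
  -- term `d i(X)η` of Cartan's formula is zero.
  have key : ∀ u w, fderiv ℝ η x u ![X x, w] + η x ![fderiv ℝ X x u, w] =
      -fderiv ℝ (fderiv ℝ f) x u w := by
    intro u w
    have h2 := (flatL E).hasFDerivAt_of_bilinear hη.hasFDerivAt hX.hasFDerivAt
    have h3 : (fun y => flatL E (η y) (X y)) =ᶠ[𝓝 x] fun y => -fderiv ℝ f y :=
      h.mono fun y hy => by ext v; rw [flatL_apply, hy]; rfl
    have h4 := (h2.congr_of_eventuallyEq h3.symm).unique hdf.hasFDerivAt.neg
    have h5 := congrArg (fun A : E →L[ℝ] E →L[ℝ] ℝ => A u w) h4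
    simp [flatL_apply] at h5
    linarith
  rw [extDeriv, alternatizeUncurryFin_apply_three, alternating_two_swap (η x) v]
  linear_combination key v w - key w v - hf2 v w

end Calculus

/-! ### Functional dependence: from `dt ∧ df = 0` to `f = φ(t)`. -/

section FunctionsOfAFunction

variable {E : Type*} [NormedAddCommGroup E] [NormedSpace ℝ E]

/-- A germ of smooth function on `ℝ` is the germ of a function smooth everywhere. -/
theorem exists_contDiff_eventuallyEq {g : ℝ → ℝ} {c : ℝ}
    (hg : ∀ᶠ r in 𝓝 c, ContDiffAt ℝ ∞ g r) : ∃ φ : ℝ → ℝ, ContDiff ℝ ∞ φ ∧ φ =ᶠ[𝓝 c] g := by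
  obtain ⟨ε, hε, hb⟩ := Metric.eventually_nhds_iff_ball.1 hg
  -- The support of the bump, of radius `ε / 2`, stays inside the ball of radius `ε` where `g` is
  -- smooth.
  let b : ContDiffBump c := ⟨ε / 4, ε / 2, by positivity, by linarith⟩
  refine ⟨fun r => b r * g r, contDiff_iff_contDiffAt.2 fun r => ?_, ?_⟩
  · by_cases hr' : r ∈ tsupport b
    swap
    · refine (contDiffAt_const (c := (0 : ℝ))).congr_of_eventuallyEq ?_
      filter_upwards [notMem_tsupport_iff_eventuallyEq.1 hr'] with r hr
      simp [hr]
    rw [b.tsupport_eq] at hr'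
    exact b.contDiff.contDiffAt.mul (hb r (Metric.closedBall_subset_ball (by
      change ε / 2 < ε; linarith) hr'))
  · filter_upwards [b.eventuallyEq_one] with r hr
    simp [hr]

/-- If `df ∧ dt = 0` near a point where `dt ≠ 0`, then `f` is a function of `t` near this point. -/
theorem exists_contDiff_comp_eq [CompleteSpace E] {t f : E → ℝ} {x : E}
    (ht : ∀ᶠ y in 𝓝 x, ContDiffAt ℝ ∞ t y) (hf : ∀ᶠ y in 𝓝 x, ContDiffAt ℝ ∞ f y)
    (hx : fderiv ℝ t x ≠ 0)
    (h : ∀ᶠ y in 𝓝 x, ∀ u v,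
      fderiv ℝ t y u * fderiv ℝ f y v = fderiv ℝ t y v * fderiv ℝ f y u) :
    ∃ φ : ℝ → ℝ, ContDiff ℝ ∞ φ ∧ ∀ᶠ y in 𝓝 x, f y = φ (t y) := by
  set l := fderiv ℝ t x with hl
  obtain ⟨v, hv⟩ : ∃ v, l v = 1 := by
    obtain ⟨w, hw⟩ : ∃ w, l w ≠ 0 := by
      by_contra! hcon
      exact hx (ContinuousLinearMap.ext hcon)
    exact ⟨(l w)⁻¹ • w, by simp [hw]⟩
  -- `Φ` straightens `t`: since `l v = 1`, one has `l ∘ Φ = t`, and `Φ` has derivative the identity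
  -- at `x` because `l` is the derivative of `t` there.
  set Φ : E → E := fun y => y + (t y - l y) • v with hΦdef
  have hlΦ : ∀ y, l (Φ y) = t y := fun y => by simp [hΦdef, hv]
  have hΦ : ∀ᶠ y in 𝓝 x, ContDiffAt ℝ ∞ Φ y := ht.mono fun y hy =>
    contDiffAt_id.add ((hy.sub l.contDiff.contDiffAt).smul contDiffAt_const)
  have hΦd : ∀ {y}, ContDiffAt ℝ ∞ t y →
      HasFDerivAt Φ (ContinuousLinearMap.id ℝ E + (fderiv ℝ t y - l).smulRight v) y := fun hy =>
    (hasFDerivAt_id _).add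
      (((hy.differentiableAt (by simp)).hasFDerivAt.sub l.hasFDerivAt).smul_const v)
  have hΦx : HasFDerivAt Φ ((ContinuousLinearEquiv.refl ℝ E : E ≃L[ℝ] E) : E →L[ℝ] E) x := by
    refine (hΦd ht.self_of_nhds).congr_fderiv ?_
    ext u
    simp [hl]
  let e := hΦ.self_of_nhds.toOpenPartialHomeomorph Φ hΦx (by simp)
  have he : ∀ y, e y = Φ y := fun y => rfl
  have hxs : x ∈ e.source := hΦ.self_of_nhds.mem_toOpenPartialHomeomorph_source hΦx (by simp)
  -- Smoothness of `e.symm` is needed around `Φ x`, not only at this point, so the derivative of `Φ`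
  -- must be invertible around `x`.
  have hequiv : ∀ᶠ y in 𝓝 x, ∃ A : E ≃L[ℝ] E, HasFDerivAt Φ (A : E →L[ℝ] E) y := by
    have hc : ContinuousAt (fderiv ℝ Φ) x :=
      (hΦ.self_of_nhds.fderiv_right (m := ∞) (by simp)).continuousAt
    have hm := ContinuousLinearEquiv.nhds (ContinuousLinearEquiv.refl ℝ E)
    rw [← hΦx.fderiv] at hm
    filter_upwards [hc.eventually hm, hΦ] with y ⟨A, hA⟩ hy
    exact ⟨A, hA ▸ (hy.differentiableAt (by simp)).hasFDerivAt⟩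
  have hsymm : Filter.Tendsto e.symm (𝓝 (Φ x)) (𝓝 x) := e.tendsto_symm hxs
  have hgood : ∀ᶠ z in 𝓝 (Φ x), ContDiffAt ℝ ∞ (f ∘ e.symm) z ∧
      ∀ w, l w = 0 → fderiv ℝ (f ∘ e.symm) z w = 0 := by
    filter_upwards [hsymm.eventually ht, hsymm.eventually hf, hsymm.eventually hΦ,
      hsymm.eventually h, hsymm.eventually hequiv, e.open_target.mem_nhds (e.map_source hxs)]
      with z h1 h2 h3 h4 ⟨A, hA⟩ hz
    have hs : ContDiffAt ℝ ∞ e.symm z := e.contDiffAt_symm hz hA h3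
    refine ⟨h2.comp z hs, fun w hw => ?_⟩
    have hsd := hs.differentiableAt (by simp)
    have htd : fderiv ℝ t (e.symm z) ∘L fderiv ℝ e.symm z = l := by
      rw [← fderiv_comp z (h1.differentiableAt (by simp)) hsd]
      have : t ∘ e.symm =ᶠ[𝓝 z] l := by
        filter_upwards [e.open_target.mem_nhds hz] with z' hz'
        rw [Function.comp_apply, ← hlΦ, ← he, e.right_inv hz']
      rw [this.fderiv_eq, ContinuousLinearMap.fderiv]
    have htd' : ∀ u, fderiv ℝ t (e.symm z) (fderiv ℝ e.symm z u) = l u := fun u => by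
      rw [← htd]; rfl
    rw [fderiv_comp z (h2.differentiableAt (by simp)) hsd, ContinuousLinearMap.comp_apply]
    -- On these two vectors `dt` takes the values `l v = 1` and `l w = 0`, so `df` vanishes on the
    -- second.
    have := h4 (fderiv ℝ e.symm z v) (fderiv ℝ e.symm z w)
    rw [htd', htd', hv, hw] at this
    linarith
  obtain ⟨ε, hε, hball⟩ := Metric.eventually_nhds_iff_ball.1 hgood
  -- A line transverse to the levels of `l`, parametrized by `l (γ r) = r`; `φ` is the germ of `f ∘
  -- e.symm` along it.
  set γ : ℝ → E := fun r => Φ x + (r - t x) • v with hγ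
  have hγc : ContDiff ℝ ∞ γ := by fun_prop
  have hγx : γ (t x) = Φ x := by simp [hγ]
  have hγball : ∀ᶠ r in 𝓝 (t x), γ r ∈ Metric.ball (Φ x) ε :=
    hγc.continuous.continuousAt.eventually (by rw [hγx]; exact Metric.ball_mem_nhds _ hε)
  obtain ⟨φ, hφ, hφe⟩ := exists_contDiff_eventuallyEq (g := (f ∘ e.symm) ∘ γ) (c := t x)
    (hγball.mono fun r hr => (hball _ hr).1.comp r hγc.contDiffAt)
  refine ⟨φ, hφ, ?_⟩
  have htc : ContinuousAt t x := ht.self_of_nhds.continuousAt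
  have hΦc : ContinuousAt Φ x := hΦ.self_of_nhds.continuousAt
  filter_upwards [e.open_source.mem_nhds hxs, htc.eventually hφe, htc.eventually hγball,
    hΦc.eventually (Metric.ball_mem_nhds _ hε)] with y hys hy1 hy2 hy3
  rw [hy1]
  -- `Φ y` and `γ (t y)` have the same image under `l`, and `f ∘ e.symm` has zero derivative along
  -- the kernel of `l`.
  obtain ⟨z, hz, hzeq⟩ := domain_mvt (f := f ∘ e.symm) (s := Metric.ball (Φ x) ε)
    (f' := fderiv ℝ (f ∘ e.symm))
    (fun z hz => ((hball z hz).1.differentiableAt (by simp)).hasFDerivAt.hasFDerivWithinAt)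
    (convex_ball _ _) hy2 hy3
  have hz' := (convex_ball (Φ x) ε).segment_subset hy2 hy3 hz
  rw [(hball z hz').2 (Φ y - γ (t y)) (by simp [hγ, hlΦ, hv])] at hzeq
  have : (f ∘ e.symm) (Φ y) = f y := by rw [← he, Function.comp_apply, e.left_inv hys]
  rw [this] at hzeq
  simp only [Function.comp_apply] at hzeq ⊢
  linarith

end FunctionsOfAFunction

/-! ### Regularity of Hamiltonian fields. -/

section HamiltonianField

variable {E : Type*} [NormedAddCommGroup E] [NormedSpace ℝ E] [FiniteDimensional ℝ E]

/-- `X` solves the linear equation `i(X)η = -df`, which is injective in `X` and has smooth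
coefficients. -/
theorem contDiffAt_hamiltonianField {η : E → E [⋀^Fin 2]→L[ℝ] ℝ} {X : E → E} {f : E → ℝ} {x : E}
    (hη : ContDiffAt ℝ ∞ η x) (hn : Nondeg (η x)) (hf : ContDiffAt ℝ ∞ f x)
    (h : ∀ᶠ y in 𝓝 x, ∀ v, η y ![X y, v] = -fderiv ℝ f y v) : ContDiffAt ℝ ∞ X x := by
  refine contDiffAt_of_clm_apply_eq (T := fun y => flatL E (η y)) (h := fun y => -fderiv ℝ f y)
    (contDiffAt_const.clm_apply hη) hn.flatL_injective
    (hf.fderiv_right (m := ∞) (by simp)).neg (h.mono fun y hy => ?_)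
  ext v
  rw [flatL_apply, hy]
  rfl

end HamiltonianField

/-! ### Forms, fields and functions in charts. -/

section Charts

open ContinuousAlternatingMap

variable {n k : ℕ} {M : Type*} [TopologicalSpace M]
  [ChartedSpace (EuclideanSpace ℝ (Fin (2 * n))) M]

/-- The model space. -/
abbrev ModelE (n : ℕ) : Type := EuclideanSpace ℝ (Fin (2 * n))

/-- The value of a form at a point, on the model space. -/
def formAt (α : DForm n M k) (x : M) : ModelE n [⋀^Fin k]→L[ℝ] ℝ := α x

/-- The value of a vector field at a point, in the model space. -/
def fieldAt (X : VField n M) (x : M) : ModelE n := X x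

/-- The derivative of the chart at `p`, on the model space. -/
def chartDeriv (p x : M) : ModelE n →L[ℝ] ModelE n :=
  mfderiv (𝓡 (2 * n)) (𝓡 (2 * n)) (chartAt (ModelE n) p) x

/-- The derivative of the inverse of the chart at `p`, on the model space. -/
def chartSymmDeriv (p : M) (y : ModelE n) : ModelE n →L[ℝ] ModelE n :=
  mfderiv (𝓡 (2 * n)) (𝓡 (2 * n)) (chartAt (ModelE n) p).symm y

/-- The derivative of a function, on the model space. -/
def funDeriv (f : M → ℝ) (x : M) : ModelE n →L[ℝ] ℝ :=
  mfderiv (𝓡 (2 * n)) 𝓘(ℝ, ℝ) f x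

/-- Tangent spaces are the model space by definition; restating everything there lets the
normed-space lemmas apply. -/
theorem chartForm_eq (p : M) (α : DForm n M k) (y : ModelE n) :
    chartForm p α y = (formAt α ((chartAt (ModelE n) p).symm y)).compContinuousLinearMap
      (chartSymmDeriv p y) := rfl

theorem chartField_eq (p : M) (X : VField n M) (y : ModelE n) :
    chartField p X y = chartDeriv p ((chartAt (ModelE n) p).symm y)
      (fieldAt X ((chartAt (ModelE n) p).symm y)) := rfl

theorem formAt_dForm (α : DForm n M k) (x : M) :
    formAt (dForm α) x = (extDeriv (chartForm x α) (chartAt (ModelE n) x x)).compContinuousLinearMap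
      (chartDeriv x x) := rfl

/-- The expression of a `1`-form in the chart at `p`, as a field of linear forms. -/
def chartOneForm (p : M) (σ : DForm n M 1) (y : ModelE n) : ModelE n →L[ℝ] ℝ :=
  (ofSubsingletonLIE (𝕜 := ℝ) (E := ModelE n) (F := ℝ) (0 : Fin 1)).symm (chartForm p σ y)

theorem chartOneForm_apply (p : M) (σ : DForm n M 1) (y v : ModelE n) :
    chartOneForm p σ y v =
      formAt σ ((chartAt (ModelE n) p).symm y) ![chartSymmDeriv p y v] := by
  change chartForm p σ y (fun _ => v) = _
  rw [chartForm_eq, compContinuousLinearMap_apply]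
  congr 1
  ext1 i
  fin_cases i
  rfl

theorem chartForm_two_apply (p : M) (Ω : DForm n M 2) (y v w : ModelE n) :
    chartForm p Ω y ![v, w] = formAt Ω ((chartAt (ModelE n) p).symm y)
      ![chartSymmDeriv p y v, chartSymmDeriv p y w] := by
  rw [chartForm_eq, compContinuousLinearMap_apply]
  congr 1
  ext1 i
  fin_cases i <;> rfl

variable [IsManifold (𝓡 (2 * n)) ∞ M]

theorem isManifold_one : IsManifold (𝓡 (2 * n)) 1 M :=
  IsManifold.of_le (n := ∞) (by exact_mod_cast (le_top : (1 : ℕ∞) ≤ ⊤))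

theorem chartDeriv_comp_symm (p : M) {y : ModelE n} (hy : y ∈ (chartAt (ModelE n) p).target) :
    chartDeriv p ((chartAt (ModelE n) p).symm y) ∘L chartSymmDeriv p y =
      ContinuousLinearMap.id ℝ (ModelE n) := by
  have := isManifold_one (n := n) (M := M)
  exact (mdifferentiable_chart (I := 𝓡 (2 * n)) p).comp_symm_deriv hy

theorem chartSymmDeriv_comp (p : M) {x : M} (hx : x ∈ (chartAt (ModelE n) p).source) :
    chartSymmDeriv p (chartAt (ModelE n) p x) ∘L chartDeriv p x =
      ContinuousLinearMap.id ℝ (ModelE n) := by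
  have := isManifold_one (n := n) (M := M)
  exact (mdifferentiable_chart (I := 𝓡 (2 * n)) p).symm_comp_deriv hx

theorem chartDeriv_apply_symm (p : M) {y : ModelE n} (hy : y ∈ (chartAt (ModelE n) p).target)
    (v : ModelE n) :
    chartDeriv p ((chartAt (ModelE n) p).symm y) (chartSymmDeriv p y v) = v :=
  congrArg (fun A : ModelE n →L[ℝ] ModelE n => A v) (chartDeriv_comp_symm p hy)

theorem chartSymmDeriv_apply (p : M) {y : ModelE n} (hy : y ∈ (chartAt (ModelE n) p).target)
    (v : ModelE n) :
    chartSymmDeriv p y (chartDeriv p ((chartAt (ModelE n) p).symm y) v) = v := by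
  have := chartSymmDeriv_comp p ((chartAt (ModelE n) p).map_target hy)
  rw [(chartAt (ModelE n) p).right_inv hy] at this
  exact congrArg (fun A : ModelE n →L[ℝ] ModelE n => A v) this

/-- The chart at `x` is the one that identifies `T_x M` with the model space. -/
theorem chartDeriv_self (x : M) : chartDeriv x x = ContinuousLinearMap.id ℝ (ModelE n) := by
  have := isManifold_one (n := n) (M := M)
  have h := mfderiv_chartAt_eq_tangentCoordChange (I := 𝓡 (2 * n)) (mem_chart_source (ModelE n) x)
  refine ContinuousLinearMap.ext fun v => ?_
  have h2 := tangentCoordChange_self (I := 𝓡 (2 * n)) (x := x) (z := x) (v := v)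
    (by simp)
  exact (congrArg (fun A : ModelE n →L[ℝ] ModelE n => A v) h).trans h2

theorem chartSymmDeriv_self (x : M) :
    chartSymmDeriv x (chartAt (ModelE n) x x) = ContinuousLinearMap.id ℝ (ModelE n) := by
  have := chartSymmDeriv_comp x (mem_chart_source (ModelE n) x)
  rwa [chartDeriv_self, ContinuousLinearMap.comp_id] at this

theorem chartForm_self (x : M) (α : DForm n M k) :
    chartForm x α (chartAt (ModelE n) x x) = formAt α x := by
  rw [chartForm_eq, chartSymmDeriv_self,
    (chartAt (ModelE n) x).left_inv (mem_chart_source (ModelE n) x)]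
  rfl

theorem chartField_self (x : M) (X : VField n M) :
    chartField x X (chartAt (ModelE n) x x) = fieldAt X x := by
  rw [chartField_eq, (chartAt (ModelE n) x).left_inv (mem_chart_source (ModelE n) x),
    chartDeriv_self]
  rfl

theorem contDiffAt_transition (p q : M) {y : ModelE n} (hy : y ∈ (chartAt (ModelE n) p).target)
    (hq : (chartAt (ModelE n) p).symm y ∈ (chartAt (ModelE n) q).source) :
    ContDiffAt ℝ ∞ (chartAt (ModelE n) q ∘ (chartAt (ModelE n) p).symm) y := by
  have h1 : ContMDiffAt (𝓡 (2 * n)) (𝓡 (2 * n)) ∞ (chartAt (ModelE n) p).symm y :=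
    contMDiffOn_chart_symm.contMDiffAt ((chartAt (ModelE n) p).open_target.mem_nhds hy)
  have h2 : ContMDiffAt (𝓡 (2 * n)) (𝓡 (2 * n)) ∞ (chartAt (ModelE n) q)
      ((chartAt (ModelE n) p).symm y) :=
    contMDiffOn_chart.contMDiffAt ((chartAt (ModelE n) q).open_source.mem_nhds hq)
  exact contMDiffAt_iff_contDiffAt.1 (h2.comp y h1)

theorem fderiv_transition (p q : M) {y : ModelE n} (hy : y ∈ (chartAt (ModelE n) p).target)
    (hq : (chartAt (ModelE n) p).symm y ∈ (chartAt (ModelE n) q).source) :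
    fderiv ℝ (chartAt (ModelE n) q ∘ (chartAt (ModelE n) p).symm) y =
      chartDeriv q ((chartAt (ModelE n) p).symm y) ∘L chartSymmDeriv p y := by
  have := isManifold_one (n := n) (M := M)
  rw [← mfderiv_eq_fderiv]
  exact mfderiv_comp y ((mdifferentiable_chart (I := 𝓡 (2 * n)) q).mdifferentiableAt hq)
    ((mdifferentiable_chart (I := 𝓡 (2 * n)) p).mdifferentiableAt_symm hy)

theorem chartForm_transition (p q : M) (α : DForm n M k) {y : ModelE n}
    (hy : y ∈ (chartAt (ModelE n) p).target)
    (hq : (chartAt (ModelE n) p).symm y ∈ (chartAt (ModelE n) q).source) :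
    chartForm p α y =
      (chartForm q α ((chartAt (ModelE n) q ∘ (chartAt (ModelE n) p).symm) y)
        ).compContinuousLinearMap
        (fderiv ℝ (chartAt (ModelE n) q ∘ (chartAt (ModelE n) p).symm) y) := by
  rw [fderiv_transition p q hy hq, chartForm_eq, chartForm_eq, Function.comp_apply,
    (chartAt (ModelE n) q).left_inv hq]
  ext v
  simp only [ContinuousAlternatingMap.compContinuousLinearMap_apply]
  congr 1
  ext1 i
  simp only [Function.comp_apply, ContinuousLinearMap.comp_apply]
  exact (congrArg (fun A : ModelE n →L[ℝ] ModelE n => A (chartSymmDeriv p y (v i)))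
    (chartSymmDeriv_comp q hq)).symm

/-- The exterior derivative can be computed in any chart. -/
theorem chartForm_dForm {α : DForm n M k} (hα : IsSmoothForm α) (p : M) {y : ModelE n}
    (hy : y ∈ (chartAt (ModelE n) p).target) :
    chartForm p (dForm α) y = extDeriv (chartForm p α) y := by
  set x := (chartAt (ModelE n) p).symm y with hx
  have hxs : x ∈ (chartAt (ModelE n) x).source := mem_chart_source _ x
  -- `dForm` at `x` is computed in the chart at `x`; the transition map and the naturality of `d`
  -- under pull-back carry it to the chart at `p`.
  have h1 : chartForm p α =ᶠ[𝓝 y] fun z =>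
      (chartForm x α ((chartAt (ModelE n) x ∘ (chartAt (ModelE n) p).symm) z)
        ).compContinuousLinearMap
        (fderiv ℝ (chartAt (ModelE n) x ∘ (chartAt (ModelE n) p).symm) z) := by
    filter_upwards [(chartAt (ModelE n) p).open_target.mem_nhds hy,
      ((chartAt (ModelE n) p).continuousAt_symm hy).preimage_mem_nhds
        ((chartAt (ModelE n) x).open_source.mem_nhds hxs)] with z hz hz'
    exact chartForm_transition p x α hz hz'
  rw [h1.extDeriv_eq, extDeriv_pullback (r := ∞) ?_ (contDiffAt_transition p x hy hxs) ?_,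
    fderiv_transition p x hy hxs, ← hx, chartForm_eq, ← hx, formAt_dForm]
  · rfl
  · exact ((hα x).contDiffAt ((chartAt (ModelE n) x).open_target.mem_nhds
      ((chartAt (ModelE n) x).map_source hxs))).differentiableAt (by simp)
  · rw [minSmoothness_of_isRCLikeNormedField]; exact two_le_infty

theorem chartOneForm_self (σ : DForm n M 1) (x : M) (v : ModelE n) :
    chartOneForm x σ (chartAt (ModelE n) x x) v = formAt σ x ![v] := by
  rw [chartOneForm_apply, chartSymmDeriv_self,
    (chartAt (ModelE n) x).left_inv (mem_chart_source (ModelE n) x)]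
  rfl

/-- The derivative of a function in a chart. -/
theorem fderiv_comp_chart_symm (p : M) {f : M → ℝ} {y : ModelE n}
    (hy : y ∈ (chartAt (ModelE n) p).target)
    (hf : MDifferentiableAt (𝓡 (2 * n)) 𝓘(ℝ, ℝ) f ((chartAt (ModelE n) p).symm y)) :
    fderiv ℝ (f ∘ (chartAt (ModelE n) p).symm) y =
      funDeriv f ((chartAt (ModelE n) p).symm y) ∘L chartSymmDeriv p y := by
  have := isManifold_one (n := n) (M := M)
  rw [← mfderiv_eq_fderiv]
  exact mfderiv_comp y hf ((mdifferentiable_chart (I := 𝓡 (2 * n)) p).mdifferentiableAt_symm hy)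

theorem contDiffAt_comp_chart_symm (p : M) {f : M → ℝ} {y : ModelE n}
    (hy : y ∈ (chartAt (ModelE n) p).target)
    (hf : ContMDiffAt (𝓡 (2 * n)) 𝓘(ℝ, ℝ) ∞ f ((chartAt (ModelE n) p).symm y)) :
    ContDiffAt ℝ ∞ (f ∘ (chartAt (ModelE n) p).symm) y := by
  have h1 : ContMDiffAt (𝓡 (2 * n)) (𝓡 (2 * n)) ∞ (chartAt (ModelE n) p).symm y :=
    contMDiffOn_chart_symm.contMDiffAt ((chartAt (ModelE n) p).open_target.mem_nhds hy)
  exact contMDiffAt_iff_contDiffAt.1 (hf.comp y h1)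

/-- A vector field is smooth at `x` if and only if its expression in the chart at `x` is. -/
theorem contMDiffAt_field_iff (X : VField n M) (x : M) :
    ContMDiffAt (𝓡 (2 * n)) (𝓡 (2 * n)).tangent ∞
      (fun x => (⟨x, X x⟩ : TangentBundle (𝓡 (2 * n)) M)) x ↔
    ContDiffAt ℝ ∞ (chartField x X) (chartAt (ModelE n) x x) := by
  have := isManifold_one (n := n) (M := M)
  have hxs := mem_chart_source (ModelE n) x
  have hxt := (chartAt (ModelE n) x).map_source hxs
  rw [Bundle.contMDiffAt_section]
  -- The fibre coordinate in the tangent bundle trivialization at `x` is the derivative of the chart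
  -- at `x`.
  have key : (fun z => (trivializationAt (ModelE n) (TangentSpace (𝓡 (2 * n))) x
      (⟨z, X z⟩ : TangentBundle (𝓡 (2 * n)) M)).2) =ᶠ[𝓝 x]
      fun z => chartDeriv x z (fieldAt X z) := by
    filter_upwards [(chartAt (ModelE n) x).open_source.mem_nhds hxs] with z hz
    have := mfderiv_chartAt_eq_tangentCoordChange (I := 𝓡 (2 * n)) hz
    exact (congrArg (fun A : ModelE n →L[ℝ] ModelE n => A (fieldAt X z)) this).symm
  have h1 : ContMDiffAt (𝓡 (2 * n)) 𝓘(ℝ, ModelE n) ∞ (chartAt (ModelE n) x).symm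
      (chartAt (ModelE n) x x) :=
    contMDiffOn_chart_symm.contMDiffAt ((chartAt (ModelE n) x).open_target.mem_nhds hxt)
  have h2 : ContMDiffAt (𝓡 (2 * n)) 𝓘(ℝ, ModelE n) ∞ (chartAt (ModelE n) x) x :=
    contMDiffOn_chart.contMDiffAt ((chartAt (ModelE n) x).open_source.mem_nhds hxs)
  have key' : (fun z => chartDeriv x z (fieldAt X z)) =ᶠ[𝓝 x]
      chartField x X ∘ chartAt (ModelE n) x := by
    filter_upwards [(chartAt (ModelE n) x).open_source.mem_nhds hxs] with z hz
    rw [Function.comp_apply, chartField_eq, (chartAt (ModelE n) x).left_inv hz]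
  constructor
  · intro h
    have h3 := h.congr_of_eventuallyEq key.symm
    exact contMDiffAt_iff_contDiffAt.1
      (h3.comp_of_eq h1 ((chartAt (ModelE n) x).left_inv hxs))
  · intro h
    exact ((contMDiffAt_iff_contDiffAt.2 h).comp x h2).congr_of_eventuallyEq (key.trans key')

end Charts

/-! ### The Lee form: smoothness, closedness and local primitives. -/

section LeeForm

open ContinuousAlternatingMap

variable {n : ℕ} {M : Type*} [TopologicalSpace M]
  [ChartedSpace (EuclideanSpace ℝ (Fin (2 * n))) M] {Ω : DForm n M 2} {σ : DForm n M 1}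

theorem five_le_finrank (hn : 3 ≤ n) : 5 ≤ Module.finrank ℝ (ModelE n) := by
  rw [finrank_euclideanSpace_fin]
  omega

theorem IsAlmostSymplectic.nondeg (hΩ : IsAlmostSymplectic Ω) (x : M) : Nondeg (formAt Ω x) :=
  hΩ.nondegenerate x

/-- The hypothesis `dΩ = σ ∧ Ω`. -/
def HasLeeForm (Ω : DForm n M 2) (σ : DForm n M 1) : Prop :=
  ∀ x, dForm Ω x = wedge (σ x) (Ω x)

theorem IsSmoothForm.contDiffAt {k : ℕ} {α : DForm n M k} (hα : IsSmoothForm α) (p : M)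
    {y : ModelE n} (hy : y ∈ (chartAt (ModelE n) p).target) :
    ContDiffAt ℝ ∞ (chartForm p α) y :=
  (hα p).contDiffAt ((chartAt (ModelE n) p).open_target.mem_nhds hy)

theorem chartForm_eq_chartOneForm (p : M) (σ : DForm n M 1) :
    chartForm p σ = (ofSubsingletonLIE (𝕜 := ℝ) (E := ModelE n) (F := ℝ) (0 : Fin 1)) ∘
      chartOneForm p σ := by
  ext1 y
  exact (LinearIsometryEquiv.apply_symm_apply _ _).symm

variable [IsManifold (𝓡 (2 * n)) ∞ M]

theorem IsAlmostSymplectic.nondeg_chartForm (hΩ : IsAlmostSymplectic Ω) (p : M) {y : ModelE n}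
    (hy : y ∈ (chartAt (ModelE n) p).target) : Nondeg (chartForm p Ω y) := by
  intro v hv
  have h0 : chartSymmDeriv p y v = 0 := by
    refine hΩ.nondeg ((chartAt (ModelE n) p).symm y) _ fun w => ?_
    have := hv (chartDeriv p ((chartAt (ModelE n) p).symm y) w)
    rwa [chartForm_two_apply, chartSymmDeriv_apply p hy] at this
  rw [← chartDeriv_apply_symm p hy v, h0, _root_.map_zero]

/-- Validity on the whole target of a single fixed chart is what allows the relation to be
differentiated once more. -/
theorem HasLeeForm.extDeriv_chartForm (hd : HasLeeForm Ω σ) (hΩ : IsAlmostSymplectic Ω) (p : M)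
    {y : ModelE n} (hy : y ∈ (chartAt (ModelE n) p).target) :
    extDeriv (chartForm p Ω) y = wedgeL (ModelE n) (chartOneForm p σ y) (chartForm p Ω y) := by
  rw [← chartForm_dForm hΩ.smooth p hy]
  ext v
  have hv : v = ![v 0, v 1, v 2] := by ext1 i; fin_cases i <;> rfl
  rw [hv, wedgeL_apply, chartForm_eq, compContinuousLinearMap_apply]
  have h1 : formAt (dForm Ω) ((chartAt (ModelE n) p).symm y) =
      wedge (formAt σ ((chartAt (ModelE n) p).symm y))
        (formAt Ω ((chartAt (ModelE n) p).symm y)) := hd _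
  have h2 : chartSymmDeriv p y ∘ ![v 0, v 1, v 2] =
      ![chartSymmDeriv p y (v 0), chartSymmDeriv p y (v 1), chartSymmDeriv p y (v 2)] := by
    ext1 i; fin_cases i <;> rfl
  rw [h1, h2, wedge_one_two_apply]
  simp only [chartOneForm_apply, chartForm_two_apply]

theorem HasLeeForm.eventually_extDeriv (hd : HasLeeForm Ω σ) (hΩ : IsAlmostSymplectic Ω) (p : M)
    {y : ModelE n} (hy : y ∈ (chartAt (ModelE n) p).target) :
    ∀ᶠ z in 𝓝 y, extDeriv (chartForm p Ω) z =
      wedgeL (ModelE n) (chartOneForm p σ z) (chartForm p Ω z) := by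
  filter_upwards [(chartAt (ModelE n) p).open_target.mem_nhds hy] with z hz
  exact hd.extDeriv_chartForm hΩ p hz

theorem HasLeeForm.contDiffAt_chartOneForm (hn : 3 ≤ n) (hd : HasLeeForm Ω σ)
    (hΩ : IsAlmostSymplectic Ω) (p : M) {y : ModelE n} (hy : y ∈ (chartAt (ModelE n) p).target) :
    ContDiffAt ℝ ∞ (chartOneForm p σ) y :=
  contDiffAt_of_extDeriv_eq_wedge (five_le_finrank hn) (hΩ.smooth.contDiffAt p hy)
    (hΩ.nondeg_chartForm p hy) (hd.eventually_extDeriv hΩ p hy)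

theorem HasLeeForm.fderiv_symm (hn : 3 ≤ n) (hd : HasLeeForm Ω σ)
    (hΩ : IsAlmostSymplectic Ω) (p : M) {y : ModelE n} (hy : y ∈ (chartAt (ModelE n) p).target)
    (u v : ModelE n) :
    fderiv ℝ (chartOneForm p σ) y u v = fderiv ℝ (chartOneForm p σ) y v u :=
  fderiv_symm_of_extDeriv_eq_wedge (five_le_finrank hn) (hΩ.smooth.contDiffAt p hy)
    (hΩ.nondeg_chartForm p hy) (hd.eventually_extDeriv hΩ p hy) u v

/-- The Lee form is smooth and closed. -/
theorem HasLeeForm.isClosedForm (hn : 3 ≤ n) (hd : HasLeeForm Ω σ) (hΩ : IsAlmostSymplectic Ω) :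
    IsClosedForm σ := by
  refine ⟨fun p y hy => ?_, fun x => ?_⟩
  · rw [chartForm_eq_chartOneForm]
    exact ((LinearIsometryEquiv.contDiff _).contDiffAt.comp y
      (hd.contDiffAt_chartOneForm hn hΩ p hy)).contDiffWithinAt
  · have hxt := (chartAt (ModelE n) x).map_source (mem_chart_source (ModelE n) x)
    have h0 : extDeriv (chartForm x σ) (chartAt (ModelE n) x x) = 0 := by
      ext v
      have hv : v = ![v 0, v 1] := by ext1 i; fin_cases i <;> rfl
      rw [hv, extDeriv, alternatizeUncurryFin_apply_two, chartForm_eq_chartOneForm,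
        LinearIsometryEquiv.comp_fderiv]
      have := hd.fderiv_symm hn hΩ x hxt (v 0) (v 1)
      exact sub_eq_zero.2 this
    change formAt (dForm σ) x = 0
    rw [formAt_dForm, h0]
    rfl

theorem IsPrimitiveOn.chartOneForm_eq {U : Set M} {t : M → ℝ} (ht : IsPrimitiveOn σ U t)
    (hU : IsOpen U) (p : M) {y : ModelE n} (hy : y ∈ (chartAt (ModelE n) p).target)
    (hyU : (chartAt (ModelE n) p).symm y ∈ U) :
    fderiv ℝ (t ∘ (chartAt (ModelE n) p).symm) y = chartOneForm p σ y := by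
  rw [fderiv_comp_chart_symm p hy
    ((ht.1.contMDiffAt (hU.mem_nhds hyU)).mdifferentiableAt (by simp))]
  ext v
  rw [chartOneForm_apply]
  exact (ht.2 _ hyU _).symm

/-- `exp (-t) Ω` is closed if `dΩ = dt ∧ Ω`. -/
theorem HasLeeForm.dForm_exp_smul (hd : HasLeeForm Ω σ)
    (hΩ : IsAlmostSymplectic Ω) {U : Set M} {t : M → ℝ} (hU : IsOpen U)
    (ht : IsPrimitiveOn σ U t) {x : M} (hx : x ∈ U) :
    dForm (fun y => Real.exp (-t y) • Ω y) x = 0 := by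
  have hxs := mem_chart_source (ModelE n) x
  have hxt := (chartAt (ModelE n) x).map_source hxs
  have hxx := (chartAt (ModelE n) x).left_inv hxs
  have hx' : (chartAt (ModelE n) x).symm (chartAt (ModelE n) x x) ∈ U := by rwa [hxx]
  have hdiff : DifferentiableAt ℝ (t ∘ (chartAt (ModelE n) x).symm) (chartAt (ModelE n) x x) :=
    (contDiffAt_comp_chart_symm x hxt
      (ht.1.contMDiffAt (hU.mem_nhds hx'))).differentiableAt (by simp)
  have h0 : extDeriv (chartForm x fun y => Real.exp (-t y) • Ω y) (chartAt (ModelE n) x x) = 0 := by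
    refine extDeriv_exp_neg_smul (η := chartForm x Ω) (s := chartOneForm x σ)
      (t := t ∘ (chartAt (ModelE n) x).symm)
      ((hΩ.smooth.contDiffAt x hxt).differentiableAt (by simp)) ?_
      (hd.extDeriv_chartForm hΩ x hxt)
    rw [← ht.chartOneForm_eq hU x hxt hx']
    exact hdiff.hasFDerivAt
  change formAt (dForm fun y => Real.exp (-t y) • Ω y) x = 0
  rw [formAt_dForm, h0]
  rfl

/-- A closed `1`-form is locally exact. -/
theorem HasLeeForm.exists_isPrimitiveOn (hn : 3 ≤ n) (hd : HasLeeForm Ω σ)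
    (hΩ : IsAlmostSymplectic Ω) (p : M) :
    ∃ (U : Set M) (t : M → ℝ), IsOpen U ∧ p ∈ U ∧ IsPrimitiveOn σ U t := by
  have hps := mem_chart_source (ModelE n) p
  have hpt := (chartAt (ModelE n) p).map_source hps
  obtain ⟨ε, hε, hb⟩ := Metric.isOpen_iff.1 (chartAt (ModelE n) p).open_target _ hpt
  set B := Metric.ball (chartAt (ModelE n) p p) ε
  -- Poincaré lemma on a ball, with closedness stated as symmetry of the derivative.
  obtain ⟨τ, hτ⟩ : ∃ τ : ModelE n → ℝ, ∀ y ∈ B, HasFDerivAt τ (chartOneForm p σ y) y :=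
    (convex_ball (chartAt (ModelE n) p p) ε).exists_forall_hasFDerivAt_of_fderiv_symmetric
    Metric.isOpen_ball
    (fun y hy => ((hd.contDiffAt_chartOneForm hn hΩ p (hb hy)).differentiableAt
      (by simp)).differentiableWithinAt)
    (fun y hy u v => hd.fderiv_symm hn hΩ p (hb hy) u v)
  have hτs : ContDiffOn ℝ ∞ τ B := by
    rw [contDiffOn_infty_iff_fderiv_of_isOpen Metric.isOpen_ball]
    refine ⟨fun y hy => (hτ y hy).differentiableAt.differentiableWithinAt, ?_⟩
    exact ContDiffOn.congr (f := chartOneForm p σ)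
      (fun y hy => (hd.contDiffAt_chartOneForm hn hΩ p (hb hy)).contDiffWithinAt)
      (fun y hy => (hτ y hy).fderiv)
  refine ⟨(chartAt (ModelE n) p).source ∩ chartAt (ModelE n) p ⁻¹' B,
    τ ∘ chartAt (ModelE n) p,
    (chartAt (ModelE n) p).isOpen_inter_preimage Metric.isOpen_ball,
    ⟨hps, Metric.mem_ball_self hε⟩, ?_, ?_⟩
  · intro x hx
    have h1 : ContMDiffAt (𝓡 (2 * n)) (𝓡 (2 * n)) ∞ (chartAt (ModelE n) p) x :=
      contMDiffOn_chart.contMDiffAt ((chartAt (ModelE n) p).open_source.mem_nhds hx.1)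
    have h2 : ContMDiffAt (𝓡 (2 * n)) 𝓘(ℝ, ℝ) ∞ τ (chartAt (ModelE n) p x) :=
      (hτs.contDiffAt (Metric.isOpen_ball.mem_nhds hx.2)).contMDiffAt
    exact (h2.comp x h1).contMDiffWithinAt
  · intro x hx v
    have := isManifold_one (n := n) (M := M)
    have h1 : mfderiv (𝓡 (2 * n)) 𝓘(ℝ, ℝ) (τ ∘ chartAt (ModelE n) p) x =
        (mfderiv (𝓡 (2 * n)) 𝓘(ℝ, ℝ) τ (chartAt (ModelE n) p x)).comp
          (mfderiv (𝓡 (2 * n)) (𝓡 (2 * n)) (chartAt (ModelE n) p) x) :=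
      mfderiv_comp x (hτ _ hx.2).differentiableAt.mdifferentiableAt
        ((mdifferentiable_chart (I := 𝓡 (2 * n)) p).mdifferentiableAt hx.1)
    rw [h1, mfderiv_eq_fderiv, (hτ _ hx.2).fderiv]
    change formAt σ x ![v] = chartOneForm p σ (chartAt (ModelE n) p x) (chartDeriv p x v)
    rw [chartOneForm_apply, (chartAt (ModelE n) p).left_inv hx.1]
    have := congrArg (fun A : ModelE n →L[ℝ] ModelE n => A v) (chartSymmDeriv_comp p hx.1)
    exact congrArg (fun w : ModelE n => formAt σ x ![w]) this.symm

theorem HasLeeForm.isLocallyConformalSymplectic (hn : 3 ≤ n) (hd : HasLeeForm Ω σ)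
    (hΩ : IsAlmostSymplectic Ω) : IsLocallyConformalSymplectic Ω σ := by
  refine ⟨hΩ, fun p => ?_⟩
  obtain ⟨U, t, hU, hp, ht⟩ := hd.exists_isPrimitiveOn hn hΩ p
  exact ⟨U, t, hU, hp, ht, fun x hx => hd.dForm_exp_smul hΩ hU ht hx⟩

end LeeForm

/-! ### Hamiltonian functions and the condition `σ ∧ df = 0`. -/

section Hamiltonian

variable {n : ℕ} {M : Type*} [TopologicalSpace M]
  [ChartedSpace (EuclideanSpace ℝ (Fin (2 * n))) M] {Ω : DForm n M 2} {σ : DForm n M 1}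
  {U : Set M} {f h : M → ℝ} {X Y : VField n M}

theorem eventually_mem_chart (hU : IsOpen U) {x : M} (hx : x ∈ U) :
    ∀ᶠ y in 𝓝 (chartAt (ModelE n) x x), y ∈ (chartAt (ModelE n) x).target ∧
      (chartAt (ModelE n) x).symm y ∈ U := by
  have hxs := mem_chart_source (ModelE n) x
  have hxt := (chartAt (ModelE n) x).map_source hxs
  filter_upwards [(chartAt (ModelE n) x).open_target.mem_nhds hxt,
    ((chartAt (ModelE n) x).continuousAt_symm hxt).preimage_mem_nhds
      (hU.mem_nhds (by rwa [(chartAt (ModelE n) x).left_inv hxs]))] with y h1 h2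
  exact ⟨h1, h2⟩

theorem exists_sharp_formAt (hΩ : IsAlmostSymplectic Ω) (x : M) (l : ModelE n →L[ℝ] ℝ) :
    ∃ S : ModelE n, ∀ v, formAt Ω x ![S, v] = l v :=
  (hΩ.nondeg x).exists_sharp (l : ModelE n →ₗ[ℝ] ℝ)

theorem exists_one_ne_zero {x : M} (hx : formAt σ x ≠ 0) : ∃ w : ModelE n, formAt σ x ![w] ≠ 0 := by
  by_contra! hcon
  refine hx (ContinuousAlternatingMap.ext fun v => ?_)
  rw [show v = ![v 0] by ext1 i; fin_cases i; rfl]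
  exact hcon _

variable [IsManifold (𝓡 (2 * n)) ∞ M]

theorem lieDeriv_two_apply (X : VField n M) (Ω : DForm n M 2) (x : M) (u v : ModelE n) :
    lieDeriv X Ω x ![u, v] =
      fderiv ℝ (chartForm x Ω) (chartAt (ModelE n) x x)
        (chartField x X (chartAt (ModelE n) x x)) ![u, v] +
      chartForm x Ω (chartAt (ModelE n) x x)
        ![fderiv ℝ (chartField x X) (chartAt (ModelE n) x x) u, v] +
      chartForm x Ω (chartAt (ModelE n) x x)
        ![u, fderiv ℝ (chartField x X) (chartAt (ModelE n) x x) v] := by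
  have hw : (fun i => chartDeriv x x ((![u, v] : Fin 2 → ModelE n) i)) = ![u, v] := by
    rw [chartDeriv_self]; rfl
  change fderiv ℝ (chartForm x Ω) (chartAt (ModelE n) x x)
      (chartField x X (chartAt (ModelE n) x x))
      (fun i => chartDeriv x x ((![u, v] : Fin 2 → ModelE n) i)) +
    ∑ i, chartForm x Ω (chartAt (ModelE n) x x)
      (Function.update (fun i => chartDeriv x x ((![u, v] : Fin 2 → ModelE n) i)) i
        (fderiv ℝ (chartField x X) (chartAt (ModelE n) x x)
          (chartDeriv x x ((![u, v] : Fin 2 → ModelE n) i)))) = _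
  rw [hw, Fin.sum_univ_two, update_pair_zero, update_pair_one, chartDeriv_self]
  simp only [Matrix.cons_val_zero, Matrix.cons_val_one, ContinuousLinearMap.id_apply]
  ring

/-- The equation `i(X)Ω = -df` in a chart. -/
theorem eventually_contraction_chart (hU : IsOpen U)
    (hf : ContMDiffOn (𝓡 (2 * n)) 𝓘(ℝ, ℝ) ∞ f U)
    (hX : ∀ x ∈ U, ∀ v : ModelE n, formAt Ω x ![fieldAt X x, v] = -funDeriv f x v)
    {x : M} (hx : x ∈ U) :
    ∀ᶠ y in 𝓝 (chartAt (ModelE n) x x), ∀ v, chartForm x Ω y ![chartField x X y, v] =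
      -fderiv ℝ (f ∘ (chartAt (ModelE n) x).symm) y v := by
  filter_upwards [eventually_mem_chart hU hx] with y ⟨hy, hyU⟩ v
  rw [chartForm_two_apply, chartField_eq, chartSymmDeriv_apply x hy, hX _ hyU,
    fderiv_comp_chart_symm x hy
      ((hf.contMDiffAt (hU.mem_nhds hyU)).mdifferentiableAt (by simp))]
  rfl

theorem contDiffAt_comp_chart_symm_self (hU : IsOpen U)
    (hf : ContMDiffOn (𝓡 (2 * n)) 𝓘(ℝ, ℝ) ∞ f U) {x : M} (hx : x ∈ U) :
    ContDiffAt ℝ ∞ (f ∘ (chartAt (ModelE n) x).symm) (chartAt (ModelE n) x x) := by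
  obtain ⟨h1, h2⟩ := (eventually_mem_chart (n := n) hU hx).self_of_nhds
  exact contDiffAt_comp_chart_symm x h1 (hf.contMDiffAt (hU.mem_nhds h2))

/-- `L_X Ω = σ(X) Ω - σ ∧ i(X)Ω` if `dΩ = σ ∧ Ω` and `i(X)Ω` is exact. -/
theorem HasLeeForm.lieDeriv_eq (hd : HasLeeForm Ω σ) (hΩ : IsAlmostSymplectic Ω)
    (hU : IsOpen U) (hf : ContMDiffOn (𝓡 (2 * n)) 𝓘(ℝ, ℝ) ∞ f U)
    (hX : ∀ x ∈ U, ∀ v : ModelE n, formAt Ω x ![fieldAt X x, v] = -funDeriv f x v)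
    {x : M} (hx : x ∈ U) (hXs : ContDiffAt ℝ ∞ (chartField x X) (chartAt (ModelE n) x x))
    (u v : ModelE n) :
    lieDeriv X Ω x ![u, v] = formAt σ x ![fieldAt X x] * formAt Ω x ![u, v] -
      formAt σ x ![u] * formAt Ω x ![fieldAt X x, v] +
      formAt σ x ![v] * formAt Ω x ![fieldAt X x, u] := by
  have hxt := (chartAt (ModelE n) x).map_source (mem_chart_source (ModelE n) x)
  rw [lieDeriv_two_apply, lieDeriv_eq_extDeriv
    ((hΩ.smooth.contDiffAt x hxt).differentiableAt (by simp)) (hXs.differentiableAt (by simp))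
    (contDiffAt_comp_chart_symm_self hU hf hx) (eventually_contraction_chart hU hf hX hx),
    hd.extDeriv_chartForm hΩ x hxt, wedgeL_apply]
  simp only [chartOneForm_self, chartForm_self, chartField_self]

theorem exists_dual_formAt (hΩ : IsAlmostSymplectic Ω) (σ : DForm n M 1) (x : M) :
    ∃ S : ModelE n, ∀ v, formAt Ω x ![S, v] = formAt σ x ![v] := by
  obtain ⟨S, hS⟩ := exists_sharp_formAt hΩ x (chartOneForm x σ (chartAt (ModelE n) x x))
  exact ⟨S, fun v => by rw [hS, chartOneForm_self]⟩

/-- If `X` is the Hamiltonian field of `f`, then `σ(X) = 0` and `σ ∧ df = 0`. -/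
theorem IsHamiltonianFieldOn.lee_eq_zero (hn : 3 ≤ n) (hd : HasLeeForm Ω σ)
    (hΩ : IsAlmostSymplectic Ω) (hU : IsOpen U) (hX : IsHamiltonianFieldOn Ω U f X)
    {x : M} (hx : x ∈ U) :
    formAt σ x ![fieldAt X x] = 0 ∧
      ∀ u v : ModelE n, formAt σ x ![u] * funDeriv f x v = formAt σ x ![v] * funDeriv f x u := by
  obtain ⟨S, hS⟩ := exists_dual_formAt hΩ σ x
  refine (hΩ.nondeg x).eq_zero_of_contraction (s := fun v => formAt σ x ![v])
    (g := fun v => funDeriv f x v) (five_le_finrank hn) hS (hX.contraction x hx) fun u v => ?_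
  rw [← hX.lieDeriv_eq_zero x hx ![u, v]]
  exact (hd.lieDeriv_eq hΩ hU hX.smooth_fun hX.contraction hx ((contMDiffAt_field_iff X x).1
    (hX.smooth_field.contMDiffAt (hU.mem_nhds hx))) u v).symm

/-- If `σ ∧ df = 0`, then `f` is Hamiltonian. -/
theorem HasLeeForm.isHamiltonianOn (hd : HasLeeForm Ω σ)
    (hΩ : IsAlmostSymplectic Ω) (hU : IsOpen U) (hf : ContMDiffOn (𝓡 (2 * n)) 𝓘(ℝ, ℝ) ∞ f U)
    (h : ∀ x ∈ U, ∀ u v : ModelE n,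
      formAt σ x ![u] * funDeriv f x v = formAt σ x ![v] * funDeriv f x u) :
    IsHamiltonianOn Ω U f := by
  -- `X` is defined on all of `M`, with whatever value `mfderiv` takes outside `U`; only its values
  -- on `U` are used.
  choose X hX using fun x : M => exists_sharp_formAt hΩ x (-funDeriv f x)
  have hX' : ∀ x ∈ U, ∀ v : ModelE n, formAt Ω x ![X x, v] = -funDeriv f x v :=
    fun x _ v => hX x v
  have hXs : ∀ x ∈ U, ContDiffAt ℝ ∞ (chartField x (X : VField n M)) (chartAt (ModelE n) x x) := by
    intro x hx
    have hxt := (chartAt (ModelE n) x).map_source (mem_chart_source (ModelE n) x)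
    exact contDiffAt_hamiltonianField (hΩ.smooth.contDiffAt x hxt) (hΩ.nondeg_chartForm x hxt)
      (contDiffAt_comp_chart_symm_self hU hf hx)
      (eventually_contraction_chart (X := X) hU hf hX' hx)
  refine ⟨X, hf, fun x hx => ((contMDiffAt_field_iff X x).2 (hXs x hx)).contMDiffWithinAt,
    fun x hx v => ?_, hX'⟩
  have h0 : formAt σ x ![X x] = 0 := by
    by_cases hσ : formAt σ x = 0
    · rw [hσ]; rfl
    obtain ⟨w, hw⟩ := exists_one_ne_zero hσ
    -- With `σ = Ω(S, ·)`, one has `σ(X) = -Ω(X, S) = df(S)`, and `σ(w) df(S) = σ(S) df(w) = 0`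
    -- because `σ(S) = Ω(S, S)`.
    obtain ⟨S, hS⟩ := exists_dual_formAt hΩ σ x
    have h1 := h x hx w S
    rw [← hS S, alternating_two_self, zero_mul] at h1
    have h2 : funDeriv f x S = 0 := (mul_eq_zero.1 h1).resolve_left hw
    rw [← hS, alternating_two_swap, hX' x hx, h2, neg_zero, neg_zero]
  have key : ∀ u v : ModelE n, lieDeriv (X : VField n M) Ω x ![u, v] = 0 := by
    intro u v
    refine (hd.lieDeriv_eq (X := X) hΩ hU hf hX' hx (hXs x hx) u v).trans ?_
    change formAt σ x ![X x] * _ - _ * formAt Ω x ![X x, _] + _ * formAt Ω x ![X x, _] = 0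
    rw [h0, hX' x hx, hX' x hx]
    linear_combination h x hx u v
  have hv : v = (![v 0, v 1] : Fin 2 → ModelE n) := by ext1 i; fin_cases i <;> rfl
  rw [hv]
  exact key _ _

end Hamiltonian

/-! ### Functions of a primitive `t` of `σ`, and Poisson brackets. -/

section FunctionsOfPrimitive

variable {n : ℕ} {M : Type*} [TopologicalSpace M]
  [ChartedSpace (EuclideanSpace ℝ (Fin (2 * n))) M] {Ω : DForm n M 2} {σ : DForm n M 1}
  {U : Set M} {t f h : M → ℝ} {X Y : VField n M}

/-- A function of `t` satisfies `dt ∧ df = 0`. -/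
theorem IsPrimitiveOn.wedge_eq_zero_of_eventually_eq (ht : IsPrimitiveOn σ U t) (hU : IsOpen U)
    {x : M} (hx : x ∈ U) {φ : ℝ → ℝ} (hφ : ContDiff ℝ ∞ φ) (hf : ∀ᶠ y in 𝓝 x, f y = φ (t y))
    (u v : ModelE n) :
    formAt σ x ![u] * funDeriv f x v = formAt σ x ![v] * funDeriv f x u := by
  have h1 : mfderiv (𝓡 (2 * n)) 𝓘(ℝ, ℝ) f x = mfderiv (𝓡 (2 * n)) 𝓘(ℝ, ℝ) (φ ∘ t) x :=
    Filter.EventuallyEq.mfderiv_eq hf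
  have h2 : mfderiv (𝓡 (2 * n)) 𝓘(ℝ, ℝ) (φ ∘ t) x =
      (mfderiv 𝓘(ℝ, ℝ) 𝓘(ℝ, ℝ) φ (t x)).comp (mfderiv (𝓡 (2 * n)) 𝓘(ℝ, ℝ) t x) :=
    mfderiv_comp x (hφ.contDiffAt.differentiableAt (by simp)).mdifferentiableAt
      ((ht.1.contMDiffAt (hU.mem_nhds hx)).mdifferentiableAt (by simp))
  have h3 : ∀ w : ModelE n, funDeriv f x w = fderiv ℝ φ (t x) (formAt σ x ![w]) := by
    intro w
    have h4 : formAt σ x ![w] = funDeriv t x w := ht.2 x hx w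
    rw [h4, ← mfderiv_eq_fderiv]
    exact congrArg (fun A : ModelE n →L[ℝ] ℝ => A w) (h1.trans h2)
  have h5 : ∀ r : ℝ, fderiv ℝ φ (t x) r = r * fderiv ℝ φ (t x) 1 := fun r => by
    rw [← smul_eq_mul, ← ContinuousLinearMap.map_smul, smul_eq_mul, mul_one]
  rw [h3, h3, h5, h5 (formAt σ x ![u])]
  ring

variable [IsManifold (𝓡 (2 * n)) ∞ M]

theorem IsPrimitiveOn.fderiv_chart_ne_zero (ht : IsPrimitiveOn σ U t) (hU : IsOpen U) {x : M}
    (hx : x ∈ U) (hσ : formAt σ x ≠ 0) :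
    fderiv ℝ (t ∘ (chartAt (ModelE n) x).symm) (chartAt (ModelE n) x x) ≠ 0 := by
  obtain ⟨h1, h2⟩ := (eventually_mem_chart (n := n) hU hx).self_of_nhds
  obtain ⟨w, hw⟩ := exists_one_ne_zero hσ
  rw [ht.chartOneForm_eq hU x h1 h2]
  intro h0
  rw [← chartOneForm_self, h0] at hw
  exact hw rfl

/-- A function `f` with `σ ∧ df = 0` is a function of `t` near the points where `σ = dt ≠ 0`. -/
theorem IsPrimitiveOn.exists_eventually_eq_comp (ht : IsPrimitiveOn σ U t) (hU : IsOpen U)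
    (hf : ContMDiffOn (𝓡 (2 * n)) 𝓘(ℝ, ℝ) ∞ f U)
    (h : ∀ x ∈ U, ∀ u v : ModelE n,
      formAt σ x ![u] * funDeriv f x v = formAt σ x ![v] * funDeriv f x u)
    {x : M} (hx : x ∈ U) (hσ : formAt σ x ≠ 0) :
    ∃ φ : ℝ → ℝ, ContDiff ℝ ∞ φ ∧ ∀ᶠ y in 𝓝 x, f y = φ (t y) := by
  have hxs := mem_chart_source (ModelE n) x
  have hev := eventually_mem_chart (n := n) hU hx
  obtain ⟨φ, hφ, hφe⟩ := exists_contDiff_comp_eq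
    (t := t ∘ (chartAt (ModelE n) x).symm) (f := f ∘ (chartAt (ModelE n) x).symm)
    (x := chartAt (ModelE n) x x)
    (hev.mono fun y hy => contDiffAt_comp_chart_symm x hy.1 (ht.1.contMDiffAt (hU.mem_nhds hy.2)))
    (hev.mono fun y hy => contDiffAt_comp_chart_symm x hy.1 (hf.contMDiffAt (hU.mem_nhds hy.2)))
    (ht.fderiv_chart_ne_zero hU hx hσ)
    (hev.mono fun y hy u v => by
      rw [ht.chartOneForm_eq hU x hy.1 hy.2, fderiv_comp_chart_symm x hy.1
        ((hf.contMDiffAt (hU.mem_nhds hy.2)).mdifferentiableAt (by simp)),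
        chartOneForm_apply, chartOneForm_apply]
      exact h _ hy.2 _ _)
  refine ⟨φ, hφ, ?_⟩
  filter_upwards [((chartAt (ModelE n) x).continuousAt hxs).eventually hφe,
    (chartAt (ModelE n) x).open_source.mem_nhds hxs] with y hy hys
  simpa only [Function.comp_apply, (chartAt (ModelE n) x).left_inv hys] using hy

/-- A function is open at the points where its differential does not vanish. -/
theorem IsPrimitiveOn.nhds_le_map (ht : IsPrimitiveOn σ U t) (hU : IsOpen U) {x : M}
    (hx : x ∈ U) (hσ : formAt σ x ≠ 0) : 𝓝 (t x) ≤ Filter.map t (𝓝 x) := by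
  have hxs := mem_chart_source (ModelE n) x
  have hne := ht.fderiv_chart_ne_zero hU hx hσ
  have hs : HasStrictFDerivAt (t ∘ (chartAt (ModelE n) x).symm)
      (fderiv ℝ (t ∘ (chartAt (ModelE n) x).symm) (chartAt (ModelE n) x x))
      (chartAt (ModelE n) x x) :=
    (contDiffAt_comp_chart_symm_self hU ht.1 hx).hasStrictFDerivAt (by simp)
  have hr := hs.map_nhds_eq_of_surj (LinearMap.range_eq_top.2
    (LinearMap.surjective fun h0 => hne (ContinuousLinearMap.coe_injective h0)))
  rw [← Filter.map_map, (chartAt (ModelE n) x).symm_map_nhds_eq hxs, Function.comp_apply,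
    (chartAt (ModelE n) x).left_inv hxs] at hr
  exact hr.ge

/-- If `t` has connected level sets, a function which is locally a function of `t` is a
function of `t`. -/
theorem IsPrimitiveOn.exists_contDiffOn_eq_comp (ht : IsPrimitiveOn σ U t) (hU : IsOpen U)
    (hσ : ∀ x ∈ U, formAt σ x ≠ 0) (hc : ∀ c : ℝ, IsPreconnected (U ∩ t ⁻¹' {c}))
    (h : ∀ x ∈ U, ∃ φ : ℝ → ℝ, ContDiff ℝ ∞ φ ∧ ∀ᶠ y in 𝓝 x, f y = φ (t y)) :
    ∃ φ : ℝ → ℝ, ContDiffOn ℝ ∞ φ (t '' U) ∧ ∀ y ∈ U, f y = φ (t y) := by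
  -- Being locally a function of `t`, `f` is locally constant on each level set, hence constant by
  -- connectedness.
  have hconst : ∀ y ∈ U, ∀ z ∈ U, t y = t z → f y = f z := by
    intro y hy z hz hyz
    refine (hc (t z)).induction₂ (fun a b => f a = f b) (fun a ha => ?_)
      (fun _ _ _ _ _ _ => Eq.trans) (fun _ _ _ _ => Eq.symm) ⟨hy, hyz⟩ ⟨hz, rfl⟩
    obtain ⟨φ, -, hφ⟩ := h a ha.1
    filter_upwards [hφ.filter_mono nhdsWithin_le_nhds, self_mem_nhdsWithin] with b hb hb'
    rw [hφ.self_of_nhds, hb, show t a = t z from ha.2, show t b = t z from hb'.2]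
  classical
  -- By `hconst` the chosen point of the level set is immaterial, and the value `0` is taken only
  -- off `t '' U`.
  let φ : ℝ → ℝ := fun c => if hc : ∃ y ∈ U, t y = c then f hc.choose else 0
  have hφ : ∀ y ∈ U, f y = φ (t y) := by
    intro y hy
    have hex : ∃ z ∈ U, t z = t y := ⟨y, hy, rfl⟩
    simp only [φ, dif_pos hex]
    exact hconst y hy _ hex.choose_spec.1 hex.choose_spec.2.symm
  refine ⟨φ, ?_, hφ⟩
  rintro _ ⟨x, hx, rfl⟩
  obtain ⟨g, hg, hge⟩ := h x hx
  refine (hg.contDiffAt.congr_of_eventuallyEq ?_).contDiffWithinAt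
  -- As `t` is open at `x`, an equality of germs at `t x` may be checked after composition with `t`.
  refine ht.nhds_le_map hU hx (hσ x hx) ?_
  change ∀ᶠ y in 𝓝 x, φ (t y) = g (t y)
  filter_upwards [hge, hU.mem_nhds hx] with y hy hyU
  rw [← hφ y hyU, hy]

/-- Brings the global form back to the local criterion, which asks for `φ` smooth on all of `ℝ`: `t
'' U` is open, so the germ of `φ` at `t x` extends. -/
theorem IsPrimitiveOn.exists_contDiff_of_contDiffOn (ht : IsPrimitiveOn σ U t) (hU : IsOpen U)
    (hσ : ∀ x ∈ U, formAt σ x ≠ 0) {φ : ℝ → ℝ} (hφ : ContDiffOn ℝ ∞ φ (t '' U))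
    (hf : ∀ y ∈ U, f y = φ (t y)) {x : M} (hx : x ∈ U) :
    ∃ g : ℝ → ℝ, ContDiff ℝ ∞ g ∧ ∀ᶠ y in 𝓝 x, f y = g (t y) := by
  have hopen : IsOpen (t '' U) := by
    rw [isOpen_iff_mem_nhds]
    rintro _ ⟨y, hy, rfl⟩
    exact ht.nhds_le_map hU hy (hσ y hy) (Filter.image_mem_map (hU.mem_nhds hy))
  obtain ⟨g, hg, hge⟩ := exists_contDiff_eventuallyEq (g := φ) (c := t x)
    (Filter.eventually_of_mem (hopen.mem_nhds ⟨x, hx, rfl⟩) fun c hc =>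
      hφ.contDiffAt (hopen.mem_nhds hc))
  refine ⟨g, hg, ?_⟩
  filter_upwards [(ht.1.continuousOn.continuousAt (hU.mem_nhds hx)).eventually hge,
    hU.mem_nhds hx] with y hy hyU
  rw [hy, hf y hyU]

/-- The Poisson bracket of Hamiltonian functions vanishes where `σ ≠ 0`. -/
theorem HasLeeForm.bracket_eq_zero (hn : 3 ≤ n) (hd : HasLeeForm Ω σ)
    (hΩ : IsAlmostSymplectic Ω) (hU : IsOpen U) (hX : IsHamiltonianFieldOn Ω U f X)
    (hY : IsHamiltonianFieldOn Ω U h Y) {x : M} (hx : x ∈ U) (hσ : formAt σ x ≠ 0) :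
    formAt Ω x ![fieldAt X x, fieldAt Y x] = 0 := by
  obtain ⟨w, hw⟩ := exists_one_ne_zero hσ
  -- This reads `σ(w) df(Y) = σ(Y) df(w)`, where `σ(Y) = 0` because `Y` is Hamiltonian too.
  have h1 := (hX.lee_eq_zero hn hd hΩ hU hx).2 w (fieldAt Y x)
  rw [(hY.lee_eq_zero hn hd hΩ hU hx).1, zero_mul] at h1
  have h2 : funDeriv f x (fieldAt Y x) = 0 := (mul_eq_zero.1 h1).resolve_left hw
  have h3 : formAt Ω x ![fieldAt X x, fieldAt Y x] = -funDeriv f x (fieldAt Y x) :=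
    hX.contraction x hx _
  rw [h3, h2, neg_zero]

/-- The function `Ω(X, Y)` is continuous. -/
theorem IsAlmostSymplectic.continuousAt_apply (hΩ : IsAlmostSymplectic Ω) {x : M}
    (hX : ContDiffAt ℝ ∞ (chartField x X) (chartAt (ModelE n) x x))
    (hY : ContDiffAt ℝ ∞ (chartField x Y) (chartAt (ModelE n) x x)) :
    ContinuousAt (fun y => formAt Ω y ![fieldAt X y, fieldAt Y y]) x := by
  have hxs := mem_chart_source (ModelE n) x
  have hxt := (chartAt (ModelE n) x).map_source hxs
  have h1 : ContDiffAt ℝ ∞ (fun y => flatL (ModelE n) (chartForm x Ω y)) (chartAt (ModelE n) x x) :=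
    contDiffAt_const.clm_apply (hΩ.smooth.contDiffAt x hxt)
  have h2 := ((h1.clm_apply hX).clm_apply hY).continuousAt
  refine (h2.comp ((chartAt (ModelE n) x).continuousAt hxs)).congr ?_
  filter_upwards [(chartAt (ModelE n) x).open_source.mem_nhds hxs] with y hy
  rw [Function.comp_apply, flatL_apply, chartForm_two_apply, chartField_eq, chartField_eq,
    chartSymmDeriv_apply x ((chartAt (ModelE n) x).map_source hy),
    chartSymmDeriv_apply x ((chartAt (ModelE n) x).map_source hy),
    (chartAt (ModelE n) x).left_inv hy]

end FunctionsOfPrimitive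

end AlmostSymplectic

end

open AlmostSymplectic in
theorem corollary2p1 {n : ℕ} (hn : 3 ≤ n) {M : Type*} [TopologicalSpace M]
    [ChartedSpace (EuclideanSpace ℝ (Fin (2 * n))) M] [IsManifold (𝓡 (2 * n)) ∞ M]
    (Ω : DForm n M 2) (hΩ : IsAlmostSymplectic Ω)
    (hψ : ∀ x, psiForm (Nat.one_le_of_lt hn) Ω x = 0)
    (hσ : Dense {x : M | leeForm (Nat.one_le_of_lt hn) Ω x ≠ 0}) :
    -- `σ` is closed and `M` is locally conformal symplectic
    IsClosedForm (leeForm (Nat.one_le_of_lt hn) Ω) ∧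
    IsLocallyConformalSymplectic Ω (leeForm (Nat.one_le_of_lt hn) Ω) ∧
    -- on an open set where `σ = dt`, `f` is Hamiltonian iff `f = f(t)`
    (∀ (U : Set M) (t f : M → ℝ), IsOpen U → IsPrimitiveOn (leeForm (Nat.one_le_of_lt hn) Ω) U t →
      ContMDiffOn (𝓡 (2 * n)) 𝓘(ℝ, ℝ) ∞ f U →
      -- in general: `f = φ(t)` near the points where `σ` does not vanish
      (IsHamiltonianOn Ω U f ↔
        ∀ x ∈ U, leeForm (Nat.one_le_of_lt hn) Ω x ≠ 0 →
          ∃ φ : ℝ → ℝ, ContDiff ℝ ∞ φ ∧ ∀ᶠ y in 𝓝 x, f y = φ (t y)) ∧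
      -- globally: `f = φ(t)` on `U`, if `σ` has no zeros on `U` and `t` has connected levels
      ((∀ x ∈ U, leeForm (Nat.one_le_of_lt hn) Ω x ≠ 0) →
        (∀ c : ℝ, IsPreconnected (U ∩ t ⁻¹' {c})) →
        (IsHamiltonianOn Ω U f ↔
          ∃ φ : ℝ → ℝ, ContDiffOn ℝ ∞ φ (t '' U) ∧ ∀ y ∈ U, f y = φ (t y)))) ∧
    -- the Poisson brackets `{f, h} = Ω(X_f, X_h)` of Hamiltonian functions vanish
    (∀ (U : Set M) (f h : M → ℝ) (X Y : VField n M), IsOpen U →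
      IsHamiltonianFieldOn Ω U f X → IsHamiltonianFieldOn Ω U h Y →
      ∀ x ∈ U, Ω x ![X x, Y x] = 0) := by
  have hd : HasLeeForm Ω (leeForm (Nat.one_le_of_lt hn) Ω) := fun x => sub_eq_zero.1 (hψ x)
  -- From here on `σ` is any form with `dΩ = σ ∧ Ω` and dense non-vanishing set.
  generalize leeForm (Nat.one_le_of_lt hn) Ω = σ at hσ hd ⊢
  have hlocal : ∀ (U : Set M) (t f : M → ℝ), IsOpen U → IsPrimitiveOn σ U t →
      ContMDiffOn (𝓡 (2 * n)) 𝓘(ℝ, ℝ) ∞ f U → (IsHamiltonianOn Ω U f ↔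
        ∀ x ∈ U, formAt σ x ≠ 0 →
          ∃ φ : ℝ → ℝ, ContDiff ℝ ∞ φ ∧ ∀ᶠ y in 𝓝 x, f y = φ (t y)) := by
    intro U t f hU ht hf
    constructor
    · rintro ⟨X, hX⟩ x hx hxσ
      exact ht.exists_eventually_eq_comp hU hf
        (fun y hy => (hX.lee_eq_zero hn hd hΩ hU hy).2) hx hxσ
    · intro h
      refine hd.isHamiltonianOn hΩ hU hf fun x hx u v => ?_
      by_cases hxσ : formAt σ x = 0
      · rw [hxσ]
        change 0 * _ = 0 * _
        rw [zero_mul, zero_mul]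
      · obtain ⟨φ, hφ, hφe⟩ := h x hx hxσ
        exact ht.wedge_eq_zero_of_eventually_eq hU hx hφ hφe u v
  refine ⟨hd.isClosedForm hn hΩ, hd.isLocallyConformalSymplectic hn hΩ,
    fun U t f hU ht hf => ⟨hlocal U t f hU ht hf, fun hU0 hc => ?_⟩, ?_⟩
  · rw [hlocal U t f hU ht hf]
    constructor
    · exact fun h => ht.exists_contDiffOn_eq_comp hU hU0 hc fun x hx => h x hx (hU0 x hx)
    · rintro ⟨φ, hφ, hφe⟩ x hx -
      exact ht.exists_contDiff_of_contDiffOn hU hU0 hφ hφe hx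
  · intro U f h X Y hU hX hY x hx
    have hcont : ContinuousOn (fun y => formAt Ω y ![fieldAt X y, fieldAt Y y]) U := fun y hy =>
      (hΩ.continuousAt_apply
        ((contMDiffAt_field_iff X y).1 (hX.smooth_field.contMDiffAt (hU.mem_nhds hy)))
        ((contMDiffAt_field_iff Y y).1 (hY.smooth_field.contMDiffAt (hU.mem_nhds hy)))
        ).continuousWithinAt
    -- A nonzero value of the continuous bracket would persist on an open set, which meets the dense
    -- set where `σ ≠ 0`.
    by_contra hne
    have hopen := hcont.isOpen_inter_preimage hU (isOpen_compl_singleton (x := (0 : ℝ)))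
    obtain ⟨y, ⟨hyU, hy⟩, hyσ⟩ := hσ.inter_open_nonempty _ hopen ⟨x, hx, hne⟩
    exact hy (hd.bracket_eq_zero hn hΩ hU hX hY hyU hyσ)
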